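/- Let $K$ be a field, let $n,m\ge 0$ and $g_1,\dots,g_m\ge 0$ be integers, and let $d_{ij}$ ($1\le i\le m$, $1\le j\le g_i$) be nonnegative integers. Let $S=K[x_1,\dots,x_n,\ z_{ij}:1\le i\le m,\ 1\le j\le g_i]$ be the $\mathbb Z\times\mathbb Z^m$-graded polynomial ring with $\deg x_i=(1,\mathbf 0)$ and $\deg z_{ij}=(d_{ij},\mathbf e_i)$, where $\mathbf e_1,\dots,\mathbf e_m$ is the standard basis of $\mathbb Z^m$. Let $\mathcal U$ be a finitely generated $\mathbb Z\times\mathbb Z^m$-graded $S$-module, and for $\mathbf a\in\mathbb Z^m$ let $\mathcal U_{\mathbf a}=\bigoplus_{i\in\mathbb Z}\mathcal U_{(i,\mathbf a)}$, a finitely generated graded module over $R=K[x_1,\dots,x_n]$ (standard grading). For a finitely generated graded $R$-module $M$ with graded Betti numbers $\beta_{i,j}(M)$ (the number of basis elements of degree $j$ in the $i$-th module of a minimal graded free resolution of $M$), put $\operatorname{reg}(M)=\sup\{j-i:\beta_{i,j}(M)\neq 0\}$, so that $\operatorname{reg}(0)=-\infty$. Then there exist finitely many functions $L_1,\dots,L_c:\mathbb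 Z^m\to\mathbb Z$, $c\ge 0$, each of the form $L_k(\mathbf a)=\sum_{i=1}^m\lambda_{k,i}a_i+\lambda_{k,0}$ with $\lambda_{k,0}\in\mathbb Z$ and $\lambda_{k,i}\in\{d_{i1},\dots,d_{ig_i}\}$ for all $i=1,\dots,m$, and a vector $\mathbf b\in\mathbb N^m$, such that $$\operatorname{reg}(\mathcal U_{\mathbf a})=\max\{L_k(\mathbf a):1\le k\le c\}\qquad\text{for all }\mathbf a\in\mathbb Z^m\text{ with }\mathbf a\ge\mathbf b\text{ componentwise,}$$ where the maximum of the empty family ($c=0$) is $-\infty$ (so the case $c=0$ says that $\mathcal U_{\mathbf a}=0$ for all $\mathbf a\ge\mathbf b$). -/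

import Mathlib

/-! ### Castelnuovo–Mumford regularity over a standard graded polynomial ring -/

section Regularity

variable {K : Type*} [Field K] {n : ℕ} {M : Type*} [AddCommGroup M]
  [Module (MvPolynomial (Fin n) K) M]

/-- A minimal graded free resolution `⋯ → F₁ → F₀ → M → 0` of the graded module `M = ⨁ⱼ ℳ j` over
`R = K[x₁, …, xₙ]`, `deg xᵢ = 1`. Here `Fᵢ = ⨁ₖ R(-shift i k)` is free of finite rank `rank i`;
its `k`-th basis element is homogeneous of degree `shift i k`. -/
structure MinimalGradedFreeResolution (ℳ : ℤ → AddSubgroup M) where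
  /-- the rank of `Fᵢ` -/
  rank : ℕ → ℕ
  /-- the degrees of the basis elements of `Fᵢ` -/
  shift : (i : ℕ) → Fin (rank i) → ℤ
  /-- the differential `Fᵢ₊₁ → Fᵢ` -/
  diff : (i : ℕ) → (Fin (rank (i + 1)) → MvPolynomial (Fin n) K) →ₗ[MvPolynomial (Fin n) K]
    (Fin (rank i) → MvPolynomial (Fin n) K)
  /-- the augmentation `F₀ → M` -/
  aug : (Fin (rank 0) → MvPolynomial (Fin n) K) →ₗ[MvPolynomial (Fin n) K] M
  /-- the differentials preserve degrees -/
  diff_homogeneous : ∀ (i : ℕ) (k : Fin (rank (i + 1))) (l : Fin (rank i)),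
    MvPolynomial.IsWeightedHomogeneous (fun _ : Fin n => (1 : ℤ)) (diff i (Pi.single k 1) l)
      (shift (i + 1) k - shift i l)
  /-- the augmentation preserves degrees -/
  aug_homogeneous : ∀ k : Fin (rank 0), aug (Pi.single k 1) ∈ ℳ (shift 0 k)
  aug_surjective : Function.Surjective aug
  exact_zero : Function.Exact (diff 0) aug
  exact_succ : ∀ i : ℕ, Function.Exact (diff (i + 1)) (diff i)
  /-- minimality: `diff i` maps `Fᵢ₊₁` into `(x₁, …, xₙ) Fᵢ` -/
  minimal : ∀ (i : ℕ) (k : Fin (rank (i + 1))) (l : Fin (rank i)),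
    diff i (Pi.single k 1) l ∈ Ideal.span (Set.range (MvPolynomial.X : Fin n → _))

open scoped Classical in
/-- The graded Betti number `β_{i,j}(M)`: the number of basis elements of degree `j` in the `i`-th
module of a minimal graded free resolution of `M`. (Every finitely generated graded module has a
minimal graded free resolution, unique up to isomorphism; the value is `0` if there is none.) -/
noncomputable def gradedBetti (ℳ : ℤ → AddSubgroup M) (i : ℕ) (j : ℤ) : ℕ :=
  if h : Nonempty (MinimalGradedFreeResolution (K := K) (n := n) ℳ) then
    Fintype.card {k : Fin ((Classical.choice h).rank i) // (Classical.choice h).shift i k = j}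
  else 0

/-- The regularity `sup {j - i : β_{i,j}(M) ≠ 0}`, as an extended number; it is `-∞` for `M = 0`. -/
noncomputable def gradedReg (K : Type*) [Field K] (n : ℕ) {M : Type*} [AddCommGroup M]
    [Module (MvPolynomial (Fin n) K) M] (ℳ : ℤ → AddSubgroup M) : EReal :=
  sSup {r : EReal | ∃ (i : ℕ) (j : ℤ), gradedBetti (K := K) (n := n) ℳ i j ≠ 0 ∧
    r = (((j - (i : ℤ) : ℤ) : ℝ) : EReal)}

end Regularity

/-! ### The multigraded polynomial ring and the modules `𝒰_𝐚` -/

section Multigraded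

/-- The multidegrees of the variables of `S = K[x₁, …, xₙ, z_{ij}]`:
`deg xᵢ = (1, 𝟎)` and `deg z_{ij} = (d_{ij}, 𝐞ᵢ)`. -/
def varDegree (n : ℕ) {m : ℕ} {g : Fin m → ℕ} (d : (i : Fin m) → Fin (g i) → ℕ) :
    Fin n ⊕ (Σ i : Fin m, Fin (g i)) → ℤ × (Fin m → ℤ)
  | Sum.inl _ => (1, 0)
  | Sum.inr ⟨i, j⟩ => ((d i j : ℤ), Pi.single i 1)

/-- The `ℤ × ℤᵐ`-grading of `S`. -/
noncomputable abbrev multiGrading (K : Type*) [Field K] (n : ℕ) {m : ℕ} {g : Fin m → ℕ}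
    (d : (i : Fin m) → Fin (g i) → ℕ) :
    ℤ × (Fin m → ℤ) → Submodule K (MvPolynomial (Fin n ⊕ (Σ i : Fin m, Fin (g i))) K) :=
  MvPolynomial.weightedHomogeneousSubmodule K (varDegree n d)

/-- `𝒰_𝐚 = ⨁ᵢ 𝒰_(i, 𝐚)`, as a subgroup of `𝒰`. -/
def strand {m : ℕ} {U : Type*} [AddCommGroup U] (𝒰 : ℤ × (Fin m → ℤ) → AddSubgroup U)
    (a : Fin m → ℤ) : AddSubgroup U :=
  ⨆ i : ℤ, 𝒰 (i, a)

/-- The `ℤ`-grading of `𝒰_𝐚`, with components `𝒰_(i, 𝐚)`. -/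
def strandGrading {m : ℕ} {U : Type*} [AddCommGroup U] (𝒰 : ℤ × (Fin m → ℤ) → AddSubgroup U)
    (a : Fin m → ℤ) : ℤ → AddSubgroup (strand 𝒰 a) :=
  fun i => (𝒰 (i, a)).addSubgroupOf (strand 𝒰 a)

theorem homogeneous_smul_mem_strand (K : Type*) [Field K] (n : ℕ) {m : ℕ} {g : Fin m → ℕ}
    (d : (i : Fin m) → Fin (g i) → ℕ) {U : Type*} [AddCommGroup U]
    [Module (MvPolynomial (Fin n ⊕ (Σ i : Fin m, Fin (g i))) K) U]
    (𝒰 : ℤ × (Fin m → ℤ) → AddSubgroup U) [SetLike.GradedSMul (multiGrading K n d) 𝒰]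
    (a : Fin m → ℤ) (e : ℤ)
    (p : MvPolynomial (Fin n ⊕ (Σ i : Fin m, Fin (g i))) K)
    (hp : p ∈ multiGrading K n d (e, 0)) (u : U) (hu : u ∈ strand 𝒰 a) :
    p • u ∈ strand 𝒰 a := by
  unfold strand at hu
  refine AddSubgroup.iSup_induction (C := fun u => p • u ∈ strand 𝒰 a) _ hu ?_ ?_ ?_
  · intro i x hx
    have h := SetLike.GradedSMul.smul_mem (A := multiGrading K n d) (B := 𝒰) hp hx
    have h2 : ((e, 0) : ℤ × (Fin m → ℤ)) +ᵥ ((i, a) : ℤ × (Fin m → ℤ)) = (e + i, a) := by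
      simp [vadd_eq_add]
    rw [h2] at h
    exact AddSubgroup.mem_iSup_of_mem (S := fun i => 𝒰 (i, a)) (e + i) h
  · simp
  · intro x y hx hy
    simpa only [smul_add] using (strand 𝒰 a).add_mem hx hy

theorem rename_smul_mem_strand (K : Type*) [Field K] (n : ℕ) {m : ℕ} {g : Fin m → ℕ}
    (d : (i : Fin m) → Fin (g i) → ℕ) {U : Type*} [AddCommGroup U]
    [Module (MvPolynomial (Fin n ⊕ (Σ i : Fin m, Fin (g i))) K) U]
    (𝒰 : ℤ × (Fin m → ℤ) → AddSubgroup U) [SetLike.GradedSMul (multiGrading K n d) 𝒰]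
    (a : Fin m → ℤ) (r : MvPolynomial (Fin n) K) (u : U)
    (hu : u ∈ strand 𝒰 a) :
    (MvPolynomial.rename (Sum.inl : Fin n → Fin n ⊕ (Σ i : Fin m, Fin (g i))) r) • u
      ∈ strand 𝒰 a := by
  induction r using MvPolynomial.induction_on generalizing u with
  | C c =>
    rw [MvPolynomial.rename_C]
    exact homogeneous_smul_mem_strand K n d 𝒰 a 0 _
      (MvPolynomial.isWeightedHomogeneous_C (varDegree n d) c) u hu
  | add p q hp hq =>
    rw [map_add, add_smul]
    exact add_mem (hp u hu) (hq u hu)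
  | mul_X p i hp =>
    rw [map_mul, mul_smul, MvPolynomial.rename_X]
    exact hp _ (homogeneous_smul_mem_strand K n d 𝒰 a 1 _
      (MvPolynomial.isWeightedHomogeneous_X K (varDegree n d) (Sum.inl i)) u hu)

/-- `𝒰_𝐚` as a module over `R = K[x₁, …, xₙ] ⊆ S`. -/
@[reducible]
noncomputable def strandModule (K : Type*) [Field K] (n : ℕ) {m : ℕ} {g : Fin m → ℕ}
    (d : (i : Fin m) → Fin (g i) → ℕ) {U : Type*} [AddCommGroup U]
    [Module (MvPolynomial (Fin n ⊕ (Σ i : Fin m, Fin (g i))) K) U]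
    (𝒰 : ℤ × (Fin m → ℤ) → AddSubgroup U) [SetLike.GradedSMul (multiGrading K n d) 𝒰]
    (a : Fin m → ℤ) :
    Module (MvPolynomial (Fin n) K) (strand 𝒰 a) where
  smul r u := ⟨MvPolynomial.rename Sum.inl r • (u : U),
    rename_smul_mem_strand K n d 𝒰 a r u u.2⟩
  one_smul u := Subtype.ext <| by
    change MvPolynomial.rename Sum.inl (1 : MvPolynomial (Fin n) K) • (u : U) = u
    rw [map_one, one_smul]
  mul_smul p q u := Subtype.ext <| by
    change MvPolynomial.rename Sum.inl (p * q) • (u : U) = _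
    rw [map_mul, mul_smul]
    rfl
  smul_zero p := Subtype.ext <| smul_zero (MvPolynomial.rename Sum.inl p)
  smul_add p u v := Subtype.ext <| smul_add (MvPolynomial.rename Sum.inl p) (u : U) (v : U)
  add_smul p q u := Subtype.ext <| by
    change MvPolynomial.rename Sum.inl (p + q) • (u : U) = _
    rw [map_add, add_smul]
    rfl
  zero_smul u := Subtype.ext <| by
    change MvPolynomial.rename Sum.inl (0 : MvPolynomial (Fin n) K) • (u : U) = 0
    rw [map_zero, zero_smul]

/-- `reg (𝒰_𝐚)`, the regularity of `𝒰_𝐚` as a graded `R`-module. -/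
noncomputable def strandReg (K : Type*) [Field K] (n : ℕ) {m : ℕ} {g : Fin m → ℕ}
    (d : (i : Fin m) → Fin (g i) → ℕ) {U : Type*} [AddCommGroup U]
    [Module (MvPolynomial (Fin n ⊕ (Σ i : Fin m, Fin (g i))) K) U]
    (𝒰 : ℤ × (Fin m → ℤ) → AddSubgroup U) [SetLike.GradedSMul (multiGrading K n d) 𝒰]
    (a : Fin m → ℤ) : EReal :=
  letI := strandModule K n d 𝒰 a
  gradedReg K n (strandGrading 𝒰 a)

end Multigraded

/-- A function `L(𝐚) = ∑ᵢ λᵢ aᵢ + λ₀` on `ℤᵐ` such that, for every `i`, the coefficient `λᵢ` is one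
of `d_{i1}, …, d_{ig_i}`. -/
def IsLinearWithCoeffsIn {m : ℕ} {g : Fin m → ℕ} (d : (i : Fin m) → Fin (g i) → ℕ)
    (L : (Fin m → ℤ) → ℤ) : Prop :=
  ∃ (lam : Fin m → ℤ) (lam0 : ℤ), (∀ i, ∃ j : Fin (g i), lam i = (d i j : ℤ)) ∧
    ∀ a, L a = ∑ i, lam i * a i + lam0

/-! The basis degrees of a minimal free resolution of `M` over `R` are the degrees in which the
Koszul homology `H_i(x; M) = Tor_i(M, K)` is nonzero
(`MinimalGradedFreeResolution.exists_shift_iff`), so `reg M = sup {j - i : H_i(x; M)_j ≠ 0}`. The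
Koszul complex does not mix strands: `H_i(x; 𝒰_𝐚)_j` is the part of degree `(j, 𝐚)` of `H_i(x; 𝒰)`
(`koszulHomologyNonzero_strand_iff`). All strands are thus governed by one finitely generated graded
`S`-module, which every `x_l` annihilates.

The degrees in which a finitely generated graded module over a polynomial ring is nonzero form a
finite union of shifted monoids, each generated by the degrees of a set `J` of variables
(`exists_finite_support_description`). This comes from a variant of the prime filtration that only
records which variables kill a generator. Since the `x_l` kill the homology, `J` contains only
variables `z_{ij}`.

Consider a piece of homological degree `h` and shift `(δ₀, δ)`. If `J` meets `{z_{i1}, z_{i2}, …}`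
for every `i`, the piece contributes `δ₀ - h + ∑ᵢ λᵢ (aᵢ - δᵢ)` to the regularity of the strand `𝐚 ≥
δ`, where `λᵢ` is the largest `d_{ij}` with `z_{ij} ∈ J`: this is an upper bound
(`weight_varDegree_fst_le`), attained by a product of powers of one `z_{ij}` for each `i`
(`exists_weight_varDegree_eq`). If `J` contains no `z_{ij}` for some `i`, the piece only reaches
strands with `aᵢ = δᵢ` and is discarded by taking `bᵢ > δᵢ`. -/

/-! ### The Koszul complex with coefficients in a module -/

section Koszul

variable {A : Type*} [CommRing A] {n : ℕ} {M : Type*} [AddCommGroup M] [Module A M]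

/-- The sign `(-1) ^ #{k ∈ I | k < l}`. -/
def koszulSign {n : ℕ} (l : Fin n) (I : Finset (Fin n)) : ℤ := (-1) ^ (I.filter (· < l)).card

theorem koszulSign_mul_self (l : Fin n) (I : Finset (Fin n)) :
    koszulSign l I * koszulSign l I = 1 := by
  unfold koszulSign
  rw [← pow_add, ← two_mul, pow_mul]
  simp

theorem koszulSign_insert_of_lt {k l : Fin n} (h : k < l) {I : Finset (Fin n)} (hk : k ∉ I) :
    koszulSign l (insert k I) = -koszulSign l I := by
  unfold koszulSign
  rw [Finset.filter_insert, if_pos h, Finset.card_insert_of_notMem (by simp [hk]), pow_succ]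
  ring

theorem koszulSign_insert_of_le {k l : Fin n} (h : l ≤ k) (I : Finset (Fin n)) :
    koszulSign l (insert k I) = koszulSign l I := by
  unfold koszulSign
  rw [Finset.filter_insert, if_neg (not_lt.mpr h)]

theorem koszulSign_erase_of_lt {k l : Fin n} (h : k < l) {I : Finset (Fin n)} (hk : k ∈ I) :
    koszulSign l (I.erase k) = -koszulSign l I := by
  conv_rhs => rw [← Finset.insert_erase hk]
  rw [koszulSign_insert_of_lt h (Finset.notMem_erase k I), neg_neg]

theorem koszulSign_erase_of_le {k l : Fin n} (h : l ≤ k) (I : Finset (Fin n)) :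
    koszulSign l (I.erase k) = koszulSign l I := by
  by_cases hk : k ∈ I
  · conv_rhs => rw [← Finset.insert_erase hk]
    rw [koszulSign_insert_of_le h]
  · rw [Finset.erase_eq_of_notMem hk]

variable (A M) in
/-- Contraction of a Koszul chain with the `l`-th dual basis vector. -/
def koszulContract (l : Fin n) : (Finset (Fin n) → M) →ₗ[A] (Finset (Fin n) → M) where
  toFun c I := if l ∈ I then 0 else koszulSign l I • c (insert l I)
  map_add' c c' := by ext I; by_cases h : l ∈ I <;> simp [h]
  map_smul' r c := by ext I; by_cases h : l ∈ I <;> simp [h, smul_comm r]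

variable (A M) in
/-- Exterior multiplication of a Koszul chain by the `l`-th basis vector. -/
def koszulWedge (l : Fin n) : (Finset (Fin n) → M) →ₗ[A] (Finset (Fin n) → M) where
  toFun c I := if l ∈ I then koszulSign l I • c (I.erase l) else 0
  map_add' c c' := by ext I; by_cases h : l ∈ I <;> simp [h]
  map_smul' r c := by ext I; by_cases h : l ∈ I <;> simp [h, smul_comm r]

theorem koszulContract_apply (l : Fin n) (c : Finset (Fin n) → M) (I : Finset (Fin n)) :
    koszulContract A M l c I = if l ∈ I then 0 else koszulSign l I • c (insert l I) := rfl

theorem koszulWedge_apply (l : Fin n) (c : Finset (Fin n) → M) (I : Finset (Fin n)) :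
    koszulWedge A M l c I = if l ∈ I then koszulSign l I • c (I.erase l) else 0 := rfl

/-- Both orders insert the same two indices. Of the two signs, only that of the larger index notices
whether the smaller one is already present. -/
theorem koszulContract_contract (k l : Fin n) (c : Finset (Fin n) → M) :
    koszulContract A M k (koszulContract A M l c) =
      -koszulContract A M l (koszulContract A M k c) := by
  wlog hkl : k ≤ l generalizing k l
  · rw [this l k (not_le.mp hkl).le, neg_neg]
  ext I
  simp only [koszulContract_apply, Pi.neg_apply, Finset.mem_insert]
  rcases hkl.eq_or_lt with rfl | hlt
  · simp
  · by_cases hk : k ∈ I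
    · simp [hk]
    by_cases hl : l ∈ I
    · simp [hl]
    simp only [hk, hl, hlt.ne, hlt.ne', or_self, if_false]
    rw [koszulSign_insert_of_lt hlt hk, koszulSign_insert_of_le hlt.le, Finset.insert_comm,
      smul_smul, smul_smul, ← neg_smul]
    congr 1
    ring

/-- Splits a chain into a part without the `l`-th basis vector and a multiple of that vector; the
induction in `koszulDiff_exact_of_regular` runs on this splitting. -/
theorem koszulContract_wedge_self (l : Fin n) (c : Finset (Fin n) → M) :
    koszulContract A M l (koszulWedge A M l c) =
      c - koszulWedge A M l (koszulContract A M l c) := by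
  ext I
  simp only [koszulContract_apply, koszulWedge_apply, Pi.sub_apply, Finset.mem_insert,
    Finset.mem_erase]
  by_cases hl : l ∈ I
  · simp [hl, koszulSign_erase_of_le le_rfl, smul_smul, koszulSign_mul_self]
  · simp [hl, koszulSign_insert_of_le le_rfl, smul_smul, koszulSign_mul_self]

theorem koszulContract_wedge_of_ne {k l : Fin n} (hkl : k ≠ l) (c : Finset (Fin n) → M) :
    koszulContract A M k (koszulWedge A M l c) =
      -koszulWedge A M l (koszulContract A M k c) := by
  ext I
  simp only [koszulContract_apply, koszulWedge_apply, Pi.neg_apply, Finset.mem_insert,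
    Finset.mem_erase, hkl.symm, false_or]
  by_cases hk : k ∈ I
  · simp [hk, hkl]
  by_cases hl : l ∈ I
  · simp only [hk, hl, if_true, if_false, and_false]
    rw [Finset.erase_insert_of_ne hkl, smul_smul, smul_smul, ← neg_smul]
    congr 1
    rcases hkl.lt_or_gt with h | h
    · rw [koszulSign_insert_of_lt h hk, koszulSign_erase_of_le h.le]
      ring
    · rw [koszulSign_insert_of_le h.le, koszulSign_erase_of_lt h hl]
      ring
  · simp [hk, hl]

/-- The Koszul differential `∑_{l ∈ T} x_l τ_l` for the elements `x_l`, `l ∈ T`. -/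
def koszulDiff (x : Fin n → A) (M : Type*) [AddCommGroup M] [Module A M] (T : Finset (Fin n)) :
    (Finset (Fin n) → M) →ₗ[A] (Finset (Fin n) → M) :=
  ∑ l ∈ T, x l • koszulContract A M l

theorem koszulDiff_apply (x : Fin n → A) (T : Finset (Fin n)) (c : Finset (Fin n) → M) :
    koszulDiff x M T c = ∑ l ∈ T, x l • koszulContract A M l c := by
  simp [koszulDiff, LinearMap.sum_apply]

theorem koszulDiff_apply_apply (x : Fin n → A) (T : Finset (Fin n)) (c : Finset (Fin n) → M)
    (I : Finset (Fin n)) :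
    koszulDiff x M T c I =
      ∑ l ∈ T, x l • (if l ∈ I then 0 else koszulSign l I • c (insert l I)) := by
  rw [koszulDiff_apply, Finset.sum_apply]
  rfl

theorem koszulDiff_insert (x : Fin n → A) {T : Finset (Fin n)} {k : Fin n} (hk : k ∉ T)
    (c : Finset (Fin n) → M) :
    koszulDiff x M (insert k T) c = x k • koszulContract A M k c + koszulDiff x M T c := by
  rw [koszulDiff_apply, koszulDiff_apply, Finset.sum_insert hk]

theorem koszulContract_diff (x : Fin n → A) (T : Finset (Fin n)) (k : Fin n)
    (c : Finset (Fin n) → M) :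
    koszulContract A M k (koszulDiff x M T c) = -koszulDiff x M T (koszulContract A M k c) := by
  simp only [koszulDiff_apply, map_sum, map_smul, ← Finset.sum_neg_distrib]
  refine Finset.sum_congr rfl fun l _ => ?_
  rw [koszulContract_contract, smul_neg]

theorem koszulDiff_wedge_of_notMem (x : Fin n → A) {T : Finset (Fin n)} {k : Fin n} (hk : k ∉ T)
    (c : Finset (Fin n) → M) :
    koszulDiff x M T (koszulWedge A M k c) = -koszulWedge A M k (koszulDiff x M T c) := by
  simp only [koszulDiff_apply, map_sum, map_smul, ← Finset.sum_neg_distrib]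
  refine Finset.sum_congr rfl fun l hl => ?_
  rw [koszulContract_wedge_of_ne (ne_of_mem_of_not_mem hl hk), smul_neg]

theorem koszulDiff_diff (x : Fin n → A) (T : Finset (Fin n)) (c : Finset (Fin n) → M) :
    koszulDiff x M T (koszulDiff x M T c) = 0 := by
  induction T using Finset.induction_on with
  | empty => simp [koszulDiff]
  | insert k T hk ih =>
    have h0 : koszulContract A M k (koszulContract A M k c) = 0 := by
      ext I
      simp [koszulContract_apply]
    rw [koszulDiff_insert x hk, koszulDiff_insert x hk]
    simp only [map_add, map_smul, h0, ih, koszulContract_diff]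
    simp

/-- Wedging with the `l`-th basis vector is a homotopy between multiplication by `x_l` and `0`. -/
theorem koszulDiff_wedge (x : Fin n → A) {T : Finset (Fin n)} {l : Fin n} (hl : l ∈ T)
    (c : Finset (Fin n) → M) :
    koszulDiff x M T (koszulWedge A M l c) = x l • c - koszulWedge A M l (koszulDiff x M T c) := by
  rw [← Finset.insert_erase hl, koszulDiff_insert x (Finset.notMem_erase l T),
    koszulDiff_insert x (Finset.notMem_erase l T),
    koszulDiff_wedge_of_notMem x (Finset.notMem_erase l T), koszulContract_wedge_self]
  simp only [map_add, map_smul, smul_sub]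
  abel

theorem koszulDiff_comp (x : Fin n → A) (T : Finset (Fin n)) {N : Type*} [AddCommGroup N]
    [Module A N] (f : M →ₗ[A] N) (c : Finset (Fin n) → M) (I : Finset (Fin n)) :
    koszulDiff x N T (fun I => f (c I)) I = f (koszulDiff x M T c I) := by
  simp only [koszulDiff_apply_apply, map_sum, map_smul]
  refine Finset.sum_congr rfl fun l _ => ?_
  split_ifs
  · simp
  · rw [map_zsmul]

/-- The differential only reads values at sets `insert l I`, so the value at `∅` (homological degree
zero) may be altered freely. -/
theorem koszulDiff_congr (x : Fin n → A) (T : Finset (Fin n)) {c c' : Finset (Fin n) → M}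
    (h : ∀ I, I ≠ ∅ → c I = c' I) : koszulDiff x M T c = koszulDiff x M T c' := by
  ext I
  simp only [koszulDiff_apply_apply]
  refine Finset.sum_congr rfl fun l _ => ?_
  rw [h _ (Finset.insert_ne_empty l I)]

theorem koszulDiff_empty_apply (x : Fin n → A) (T : Finset (Fin n)) (c : Finset (Fin n) → M) :
    koszulDiff x M T c ∅ = ∑ l ∈ T, x l • c {l} := by
  rw [koszulDiff_apply_apply]
  simp [koszulSign]

/-- The chain of degree one with coefficients `y`. -/
def koszulOne (T : Finset (Fin n)) (y : Fin n → M) (I : Finset (Fin n)) : M :=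
  ∑ l ∈ T, if I = {l} then y l else 0

theorem koszulOne_singleton {T : Finset (Fin n)} {l : Fin n} (hl : l ∈ T) (y : Fin n → M) :
    koszulOne T y {l} = y l := by
  rw [koszulOne, Finset.sum_eq_single l]
  · simp
  · intro b _ hb
    rw [if_neg (by simpa using hb.symm)]
  · exact fun h => absurd hl h

theorem koszulOne_eq_zero {T : Finset (Fin n)} {I : Finset (Fin n)} (hI : ∀ l ∈ T, I ≠ {l})
    (y : Fin n → M) : koszulOne T y I = 0 :=
  Finset.sum_eq_zero fun l hl => if_neg (hI l hl)

theorem koszulDiff_one_empty (x : Fin n → A) (T : Finset (Fin n)) (y : Fin n → M) :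
    koszulDiff x M T (koszulOne T y) ∅ = ∑ l ∈ T, x l • y l := by
  rw [koszulDiff_empty_apply]
  exact Finset.sum_congr rfl fun l hl => by rw [koszulOne_singleton hl]

theorem koszulDiff_one_of_ne (x : Fin n → A) (T : Finset (Fin n)) (y : Fin n → M)
    {I : Finset (Fin n)} (hI : I ≠ ∅) : koszulDiff x M T (koszulOne T y) I = 0 := by
  rw [koszulDiff_apply_apply]
  refine Finset.sum_eq_zero fun l _ => ?_
  split_ifs with h
  · simp
  · rw [koszulOne_eq_zero, smul_zero, smul_zero]
    intro k _ hk
    obtain ⟨j, hj⟩ := Finset.nonempty_iff_ne_empty.mpr hI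
    have h1 : l = k := by simpa [hk] using Finset.mem_insert_self l I
    have h2 : j = k := by simpa [hk] using Finset.mem_insert_of_mem (b := l) hj
    exact h (by rw [h1, ← h2]; exact hj)

/-- The elements `x_l`, `l ∈ T`, taken in any order, form a weakly regular sequence. -/
theorem koszulDiff_exact_of_regular (x : Fin n → A)
    (hx : ∀ (T : Finset (Fin n)) (k : Fin n), k ∉ T → ∀ a : A,
      x k * a ∈ Ideal.span (x '' T) → a ∈ Ideal.span (x '' T))
    (T : Finset (Fin n)) (c : Finset (Fin n) → A) (hsupp : ∀ I, ¬ I ⊆ T → c I = 0)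
    (h0 : c ∅ = 0) (hc : koszulDiff x A T c = 0) :
    ∃ b : Finset (Fin n) → A, (∀ I, ¬ I ⊆ T → b I = 0) ∧ b ∅ = 0 ∧ koszulDiff x A T b = c := by
  induction T using Finset.induction_on generalizing c with
  | empty =>
    refine ⟨0, by simp, rfl, ?_⟩
    ext I
    by_cases hI : I ⊆ ∅
    · simp [Finset.subset_empty.mp hI, h0]
    · simp [hsupp I hI]
  | insert k T hk ih =>
    set τ := koszulContract A A k with hτ
    set s := koszulWedge A A k with hs
    set D := koszulDiff x A T with hD
    have hττ : ∀ c, τ (τ c) = 0 := fun c => by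
      ext I
      simp [hτ, koszulContract_apply]
    have hτs : ∀ c, τ (s c) = c - s (τ c) := koszulContract_wedge_self k
    have hτD : ∀ c, τ (D c) = -D (τ c) := koszulContract_diff x T k
    have hDs : ∀ c, D (s c) = -s (D c) := koszulDiff_wedge_of_notMem x hk
    have hD' : ∀ c, koszulDiff x A (insert k T) c = x k • τ c + D c := koszulDiff_insert x hk
    have hsuppτ : ∀ c : Finset (Fin n) → A, (∀ I, ¬ I ⊆ insert k T → c I = 0) →
        ∀ I, ¬ I ⊆ T → τ c I = 0 := by
      intro c hc I hI
      simp only [hτ, koszulContract_apply]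
      split_ifs with h
      · rfl
      · rw [hc, smul_zero]
        intro h'
        exact hI fun j hj => (Finset.mem_insert.mp (h' (Finset.mem_insert_of_mem hj))).resolve_left
          (fun e => h (e ▸ hj))
    have hsupps : ∀ c : Finset (Fin n) → A, (∀ I, ¬ I ⊆ insert k T → c I = 0) →
        ∀ I, ¬ I ⊆ insert k T → s c I = 0 := by
      intro c hc I hI
      simp only [hs, koszulWedge_apply]
      split_ifs with h
      · rw [hc, smul_zero]
        intro h'
        refine hI fun j hj => ?_
        by_cases hjk : j = k
        · simp [hjk]
        · exact h' (Finset.mem_erase.mpr ⟨hjk, hj⟩)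
      · rfl
    have hmono : ∀ c : Finset (Fin n) → A, (∀ I, ¬ I ⊆ T → c I = 0) →
        ∀ I, ¬ I ⊆ insert k T → c I = 0 := fun c hc I hI =>
      hc I fun h => hI (h.trans (Finset.subset_insert k T))
    have hτ0 : ∀ c : Finset (Fin n) → A, (∀ I, ¬ I ⊆ T → c I = 0) → τ c = 0 := by
      intro c hc
      ext I
      simp only [hτ, koszulContract_apply]
      split_ifs with h
      · rfl
      · rw [hc, smul_zero]
        · rfl
        · exact fun h' => hk (h' (Finset.mem_insert_self k I))
    set b := τ c with hb
    set a := τ (s c) with ha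
    -- The chain is `a + e_k ∧ b`, with neither `a` nor `b` involving `e_k`.
    have hcab : c = a + s b := by rw [ha, hτs, hb]; abel
    have hbsupp := hsuppτ c hsupp
    have hasupp := hsuppτ (s c) (hsupps c hsupp)
    rw [← hb] at hbsupp
    rw [← ha] at hasupp
    have hab : x k • b + D a - s (D b) = 0 := by
      have := hD' c
      rw [hc, ← hb, hcab, map_add, hDs] at this
      rw [this]
      abel
    -- Contraction with `e_k` isolates the part of the cycle condition divisible by `e_k`.
    have hDb : D b = 0 := by
      have h1 := congrArg τ hab
      rw [map_sub, map_add, map_smul, hb, hττ, hτD, ha, hττ, hτs, hτD, hττ] at h1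
      simpa using h1
    have hDa : x k • b + D a = 0 := by simpa [hDb] using hab
    -- The only use of regularity: in degree zero the relation reads `x_k b_∅ ∈ (x_l : l ∈ T)`.
    have hb0 : b ∅ ∈ Ideal.span (x '' T) := by
      refine hx T k hk _ ?_
      have h1 := congrFun hDa ∅
      simp only [Pi.add_apply, Pi.smul_apply, Pi.zero_apply, smul_eq_mul] at h1
      rw [eq_neg_of_add_eq_zero_left h1, hD, koszulDiff_empty_apply]
      refine neg_mem (Submodule.sum_mem _ fun l hl => ?_)
      exact Ideal.mul_mem_right _ _ (Ideal.subset_span ⟨l, hl, rfl⟩)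
    obtain ⟨y, hy⟩ : ∃ y : Fin n → A, ∑ l ∈ T, x l • y l = b ∅ := by
      rw [Submodule.mem_span_image_finset_iff_exists_fun] at hb0
      obtain ⟨y, hy⟩ := hb0
      refine ⟨fun l => if h : l ∈ T then y ⟨l, h⟩ else 0, ?_⟩
      rw [← hy, ← Finset.sum_coe_sort]
      exact Finset.sum_congr rfl fun l _ => by simp [mul_comm]
    have hDsupp : ∀ c : Finset (Fin n) → A, (∀ I, ¬ I ⊆ T → c I = 0) →
        ∀ I, ¬ I ⊆ T → D c I = 0 := by
      intro c hc I hI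
      rw [hD, koszulDiff_apply_apply]
      refine Finset.sum_eq_zero fun l _ => ?_
      rw [hc (insert l I) fun h => hI ((Finset.subset_insert l I).trans h)]
      simp
    have hone : ∀ I, ¬ I ⊆ T → koszulOne T y I = 0 := fun I hI =>
      koszulOne_eq_zero (fun l hl h => hI (by simpa [h] using hl)) y
    -- The induction hypothesis requires a vanishing component at `∅`, so `b_∅` is first removed by
    -- the boundary of a chain of degree one.
    obtain ⟨β', hβ's, hβ'0, hβ'⟩ := ih (b - D (koszulOne T y))
      (fun I hI => by rw [Pi.sub_apply, hbsupp I hI, hDsupp _ hone I hI, sub_zero])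
      (by rw [Pi.sub_apply, hD, koszulDiff_one_empty, hy, sub_self])
      (by rw [map_sub, hDb, hD, koszulDiff_diff, sub_zero])
    set β := β' + koszulOne T y with hβ
    have hβs : ∀ I, ¬ I ⊆ T → β I = 0 := fun I hI => by
      rw [hβ, Pi.add_apply, hβ's I hI, hone I hI, add_zero]
    have hβ0 : β ∅ = 0 := by
      rw [hβ, Pi.add_apply, hβ'0, koszulOne_eq_zero
        (fun l _ h => by simpa using congrArg (l ∈ ·) h), add_zero]
    have hDβ : D β = b := by rw [hβ, map_add, hβ', sub_add_cancel]
    obtain ⟨α, hαs, hα0, hα⟩ := ih (a + x k • β)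
      (fun I hI => by simp [hasupp I hI, hβs I hI])
      (by
        have : a ∅ = 0 := by
          have h1 := congrFun hcab ∅
          rw [h0, Pi.add_apply, hs, koszulWedge_apply] at h1
          simpa using h1.symm
        simp [this, hβ0])
      (by rw [map_add, map_smul, hDβ, add_comm, hDa])
    -- With `Dα = a + x_k β` and `Dβ = b`, the terms `x_k β` cancel and `a + e_k ∧ b` remains.
    refine ⟨α - s β, fun I hI => ?_, ?_, ?_⟩
    · rw [Pi.sub_apply, hmono α hαs I hI, hsupps β (hmono β hβs) I hI, sub_zero]
    · rw [Pi.sub_apply, hα0, hs, koszulWedge_apply]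
      simp
    · rw [hD', map_sub, map_sub, hτ0 α hαs, hα, hDs, hDβ, hτs, hτ0 β hβs, hcab]
      simp only [map_zero, smul_sub, smul_zero, sub_zero]
      abel

end Koszul

/-! ### Acyclicity of the Koszul complex of the variables -/

section KoszulPolynomial

variable {K : Type*} [Field K] {n : ℕ}

/-- The ideal is monomial: a variable in `T` dividing `X_k` times a monomial differs from `X_k`,
hence divides the monomial itself. -/
theorem X_mul_mem_span_X_image {K : Type*} [CommRing K] {σ : Type*} {T : Set σ} {k : σ} (hk : k ∉ T)
    {a : MvPolynomial σ K}
    (h : MvPolynomial.X k * a ∈ Ideal.span (MvPolynomial.X '' T : Set (MvPolynomial σ K))) :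
    a ∈ Ideal.span (MvPolynomial.X '' T : Set (MvPolynomial σ K)) := by
  rw [MvPolynomial.mem_ideal_span_X_image] at h ⊢
  intro m hm
  obtain ⟨i, hi, hi'⟩ := h (Finsupp.single k 1 + m) (by
    rw [MvPolynomial.mem_support_iff] at hm ⊢
    rwa [MvPolynomial.coeff_X_mul])
  refine ⟨i, hi, ?_⟩
  have hki : k ≠ i := fun e => hk (e ▸ hi)
  simpa [Finsupp.single_apply, hki] using hi'

/-- Exactness of the Koszul complex of the variables on a free module. -/
theorem koszulDiff_exact_pi (r : ℕ) (c : Finset (Fin n) → Fin r → MvPolynomial (Fin n) K)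
    (h0 : c ∅ = 0)
    (hc : koszulDiff (MvPolynomial.X : Fin n → MvPolynomial (Fin n) K) _ Finset.univ c = 0) :
    ∃ b, koszulDiff (MvPolynomial.X : Fin n → MvPolynomial (Fin n) K)
      (Fin r → MvPolynomial (Fin n) K) Finset.univ b = c := by
  -- The differential commutes with the coordinate projections, which reduces to rank one.
  have key : ∀ l : Fin r, ∃ b : Finset (Fin n) → MvPolynomial (Fin n) K,
      koszulDiff (MvPolynomial.X : Fin n → MvPolynomial (Fin n) K) _ Finset.univ b =
        fun I => c I l := by
    intro l
    obtain ⟨b, -, -, hb⟩ := koszulDiff_exact_of_regular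
      (MvPolynomial.X : Fin n → MvPolynomial (Fin n) K)
      (fun T k hk a h => X_mul_mem_span_X_image (by simpa using hk) h) Finset.univ
      (fun I => c I l) (fun I hI => absurd (Finset.subset_univ I) hI) (by simp [h0])
      (by
        ext1 I
        have := koszulDiff_comp (MvPolynomial.X : Fin n → MvPolynomial (Fin n) K) Finset.univ
          (LinearMap.proj (R := MvPolynomial (Fin n) K)
            (φ := fun _ : Fin r => MvPolynomial (Fin n) K) l) c I
        simpa [hc] using this)
    exact ⟨b, hb⟩
  choose b hb using key
  refine ⟨fun I l => b l I, ?_⟩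
  ext1 I
  ext1 l
  have := koszulDiff_comp (MvPolynomial.X : Fin n → MvPolynomial (Fin n) K) Finset.univ
    (LinearMap.proj (R := MvPolynomial (Fin n) K)
      (φ := fun _ : Fin r => MvPolynomial (Fin n) K) l) (fun I l => b l I) I
  simp only [LinearMap.proj_apply] at this
  rw [← this, hb]

end KoszulPolynomial

/-! ### Gradings given by projections -/

section GradedBy

/-- The subgroups `ℳ g` are the components of a grading of `M`, with projections `π g`. -/
structure IsGradedBy {G M : Type*} [AddCommGroup M] (ℳ : G → AddSubgroup M) (π : G → M →+ M) :
    Prop where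
  mem : ∀ g x, π g x ∈ ℳ g
  self : ∀ g x, x ∈ ℳ g → π g x = x
  other : ∀ g h x, x ∈ ℳ g → g ≠ h → π h x = 0
  -- Says that `x` is a finite sum of its components, phrased as an induction principle over
  -- subgroups.
  closed : ∀ (x : M) (N : AddSubgroup M), (∀ g, π g x ∈ N) → x ∈ N

variable {G M : Type*} [AddCommGroup M] {ℳ : G → AddSubgroup M} {π : G → M →+ M}

/-- Asking for every larger `t` makes the property stable under sums, via unions of index sets; the
elements having it then form a subgroup to which `closed` applies. -/
theorem IsGradedBy.exists_sum (h : IsGradedBy ℳ π) (x : M) :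
    ∃ s : Finset G, ∀ t, s ⊆ t → ∑ g ∈ t, π g x = x := by
  classical
  let N : AddSubgroup M :=
    { carrier := {x | ∃ s : Finset G, ∀ t, s ⊆ t → ∑ g ∈ t, π g x = x}
      zero_mem' := ⟨∅, by simp⟩
      add_mem' := by
        rintro x y ⟨s, hs⟩ ⟨t, ht⟩
        refine ⟨s ∪ t, fun u hu => ?_⟩
        simp only [map_add, Finset.sum_add_distrib]
        rw [hs u (Finset.union_subset_left hu), ht u (Finset.union_subset_right hu)]
      neg_mem' := by
        rintro x ⟨s, hs⟩
        refine ⟨s, fun u hu => ?_⟩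
        simp only [map_neg, Finset.sum_neg_distrib, hs u hu] }
  refine h.closed x N fun g => ⟨{g}, fun t ht => ?_⟩
  rw [Finset.sum_eq_single g]
  · exact h.self _ _ (h.mem g x)
  · exact fun k _ hk => h.other _ _ _ (h.mem g x) hk.symm
  · exact fun hg => absurd (ht (Finset.mem_singleton_self g)) hg

/-- It suffices to compare on homogeneous elements; injectivity of `φ` prevents a component of
another degree from landing in degree `φ g`. -/
theorem IsGradedBy.proj_map (h : IsGradedBy ℳ π) {G' N : Type*} [AddCommGroup N]
    {𝒩 : G' → AddSubgroup N} {ρ : G' → N →+ N} (h' : IsGradedBy 𝒩 ρ) {φ : G → G'}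
    (hφ : Function.Injective φ) (f : M →+ N) (hf : ∀ g x, x ∈ ℳ g → f x ∈ 𝒩 (φ g)) (g : G)
    (x : M) : ρ (φ g) (f x) = f (π g x) := by
  refine h.closed x (AddMonoidHom.eqLocus ((ρ (φ g)).comp f) (f.comp (π g))) fun k => ?_
  change ρ (φ g) (f (π k x)) = f (π g (π k x))
  by_cases hk : k = g
  · subst hk
    rw [h.self _ _ (h.mem k x), h'.self _ _ (hf _ _ (h.mem k x))]
  · rw [h.other _ _ _ (h.mem k x) hk, map_zero,
      h'.other _ _ _ (hf _ _ (h.mem k x)) fun e => hk (hφ e)]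

end GradedBy

/-! ### The bigrading of Koszul chains -/

section KoszulGrading

variable {G : Type*} [AddCommGroup G] {A : Type*} [CommRing A] {n : ℕ} {M : Type*} [AddCommGroup M]
  [Module A M]

/-- The bigrading of Koszul chains: the component of index `(i, g)` consists of the chains of
homological degree `i` whose internal degree is `g`, where the basis vectors have degree `e`. -/
def koszulGrading (n : ℕ) (ℳ : G → AddSubgroup M) (e : G) (p : ℤ × G) :
    AddSubgroup (Finset (Fin n) → M) where
  carrier := {c | ∀ I, ((I.card : ℤ) ≠ p.1 → c I = 0) ∧ c I ∈ ℳ (p.2 - p.1 • e)}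
  zero_mem' I := ⟨fun _ => rfl, zero_mem _⟩
  add_mem' {c c'} hc hc' I := ⟨fun h => by simp [(hc I).1 h, (hc' I).1 h],
    add_mem (hc I).2 (hc' I).2⟩
  neg_mem' {c} hc I := ⟨fun h => by simp [(hc I).1 h], neg_mem (hc I).2⟩

/-- The projections belonging to `koszulGrading`. -/
def koszulProj (n : ℕ) (π : G → M →+ M) (e : G) (p : ℤ × G) :
    (Finset (Fin n) → M) →+ (Finset (Fin n) → M) where
  toFun c I := if (I.card : ℤ) = p.1 then π (p.2 - p.1 • e) (c I) else 0
  map_zero' := by ext I; simp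
  map_add' c c' := by ext I; by_cases h : (I.card : ℤ) = p.1 <;> simp [h]

theorem koszulProj_apply (π : G → M →+ M) (e : G) (p : ℤ × G) (c : Finset (Fin n) → M)
    (I : Finset (Fin n)) :
    koszulProj n π e p c I = if (I.card : ℤ) = p.1 then π (p.2 - p.1 • e) (c I) else 0 := rfl

theorem IsGradedBy.koszul {ℳ : G → AddSubgroup M} {π : G → M →+ M} (h : IsGradedBy ℳ π)
    (n : ℕ) (e : G) : IsGradedBy (koszulGrading n ℳ e) (koszulProj n π e) where
  mem p c I := by
    rw [koszulProj_apply]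
    refine ⟨fun hI => if_neg hI, ?_⟩
    split_ifs
    · exact h.mem _ _
    · exact zero_mem _
  self p c hc := by
    ext I
    rw [koszulProj_apply]
    split_ifs with hI
    · exact h.self _ _ (hc I).2
    · exact ((hc I).1 hI).symm
  other p q c hc hpq := by
    ext I
    rw [koszulProj_apply]
    split_ifs with hI
    · by_cases hp : (I.card : ℤ) = p.1
      · refine h.other _ _ _ (hc I).2 fun heq => hpq ?_
        have h1 : p.1 = q.1 := hp.symm.trans hI
        rw [h1] at heq
        exact Prod.ext h1 (sub_left_injective heq)
      · rw [(hc I).1 hp, map_zero]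
        rfl
    · rfl
  closed c N hN := by
    classical
    choose s hs using fun I => h.exists_sum (c I)
    -- Homological degrees run from `0` to `n`. The shift by `i • e` undoes the one in `koszulProj`,
    -- so that each coefficient is cut into its own components.
    have hc : c = ∑ i ∈ Finset.range (n + 1), ∑ g ∈ Finset.univ.biUnion s,
        koszulProj n π e ((i : ℤ), g + (i : ℤ) • e) c := by
      ext I
      simp only [Finset.sum_apply, koszulProj_apply, add_sub_cancel_right]
      rw [Finset.sum_eq_single I.card]
      · simp only [if_true]
        exact (hs I _ (Finset.subset_biUnion_of_mem s (Finset.mem_univ I))).symm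
      · intro j _ hj
        refine Finset.sum_eq_zero fun g _ => if_neg ?_
        exact_mod_cast hj.symm
      · intro hI
        refine absurd (Finset.mem_range.mpr (Nat.lt_succ_of_le ?_)) hI
        simpa using Finset.card_le_univ I
    rw [hc]
    exact sum_mem fun i _ => sum_mem fun g _ => hN _

/-- The differential drops one basis vector of degree `e` and multiplies by some `x_l` of degree
`e`; hence it preserves the internal degree. -/
theorem koszulDiff_proj {π : G → M →+ M} {e : G} {x : Fin n → A}
    (hx : ∀ l g m, π (g + e) (x l • m) = x l • π g m) (i : ℤ) (g : G) (c : Finset (Fin n) → M) :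
    koszulDiff x M Finset.univ (koszulProj n π e (i + 1, g) c) =
      koszulProj n π e (i, g) (koszulDiff x M Finset.univ c) := by
  ext I
  have he : g - i • e = g - (i + 1) • e + e := by rw [add_smul, one_smul]; abel
  rw [koszulProj_apply, koszulDiff_apply_apply, koszulDiff_apply_apply]
  by_cases hI : (I.card : ℤ) = i
  · rw [if_pos hI, map_sum]
    refine Finset.sum_congr rfl fun l _ => ?_
    dsimp only
    rw [he, hx]
    split_ifs with hl
    · simp
    · rw [koszulProj_apply, if_pos, map_zsmul]
      rw [Finset.card_insert_of_notMem hl]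
      push_cast
      rw [hI]
  · rw [if_neg hI]
    refine Finset.sum_eq_zero fun l _ => ?_
    split_ifs with hl
    · simp
    · rw [koszulProj_apply, if_neg, smul_zero, smul_zero]
      rw [Finset.card_insert_of_notMem hl]
      push_cast
      exact fun h => hI (by linarith)

theorem koszulDiff_mem_koszulGrading {ℳ : G → AddSubgroup M} {e : G} {x : Fin n → A}
    (hx : ∀ l g m, m ∈ ℳ g → x l • m ∈ ℳ (g + e)) {i : ℤ} {g : G} {c : Finset (Fin n) → M}
    (hc : c ∈ koszulGrading n ℳ e (i + 1, g)) :
    koszulDiff x M Finset.univ c ∈ koszulGrading n ℳ e (i, g) := by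
  intro I
  have he : g - i • e = g - (i + 1) • e + e := by rw [add_smul, one_smul]; abel
  rw [koszulDiff_apply_apply]
  refine ⟨fun hI => Finset.sum_eq_zero fun l _ => ?_, sum_mem fun l _ => ?_⟩
  · split_ifs with hl
    · simp
    · rw [(hc (insert l I)).1, smul_zero, smul_zero]
      rw [Finset.card_insert_of_notMem hl]
      push_cast
      exact fun h => hI (by linarith)
  · dsimp only
    rw [he]
    refine hx _ _ _ ?_
    split_ifs with hl
    · exact zero_mem _
    · exact zsmul_mem (hc (insert l I)).2 _

/-- The Koszul homology of `M` with respect to the elements `x_l` is nonzero in homological degree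
`p.1` and internal degree `p.2`. -/
def KoszulHomologyNonzero (x : Fin n → A) (ℳ : G → AddSubgroup M) (e : G) (p : ℤ × G) : Prop :=
  ∃ c ∈ koszulGrading n ℳ e p, koszulDiff x M Finset.univ c = 0 ∧
    ∀ b, koszulDiff x M Finset.univ b ≠ c

end KoszulGrading

/-! ### The support of a finitely generated graded module over a polynomial ring -/

section Support

open MvPolynomial

variable {K : Type*} [Field K] {σ : Type*} {G : Type*} [AddCommGroup G] {V : Type*}
  [AddCommGroup V] [Module (MvPolynomial σ K) V] {𝒱 : G → AddSubgroup V} {π : G → V →+ V}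
  {w : σ → G}

theorem monomial_smul_mem_graded
    (hX : ∀ s g v, v ∈ 𝒱 g → (X s : MvPolynomial σ K) • v ∈ 𝒱 (g + w s)) {g : G} {v : V}
    (hv : v ∈ 𝒱 g) (α : σ →₀ ℕ) :
    (monomial α (1 : K)) • v ∈ 𝒱 (g + Finsupp.weight w α) := by
  induction α using Finsupp.induction_linear generalizing g v with
  | zero => simpa using hv
  | add α β ha hb =>
    have h : (monomial (α + β) (1 : K)) = monomial β 1 * monomial α 1 := by
      rw [monomial_mul, one_mul, add_comm]
    rw [h, mul_smul, map_add, ← add_assoc]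
    exact hb (ha hv)
  | single s k =>
    induction k with
    | zero => simpa using hv
    | succ k ih =>
      have h : (monomial (Finsupp.single s (k + 1)) (1 : K)) = X s * monomial (Finsupp.single s k) 1 := by
        rw [X, monomial_mul, one_mul, add_comm, ← Finsupp.single_add]
      rw [h, mul_smul, Finsupp.single_add, map_add, ← add_assoc]
      have := hX s _ _ ih
      simpa [Finsupp.weight_single] using this

theorem smul_eq_sum_monomial_smul (p : MvPolynomial σ K) (v : V) :
    p • v = ∑ α ∈ p.support, (C (p.coeff α) : MvPolynomial σ K) • (monomial α (1 : K)) • v := by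
  conv_lhs => rw [p.as_sum, Finset.sum_smul]
  refine Finset.sum_congr rfl fun α _ => ?_
  rw [← mul_smul, C_mul_monomial, mul_one]

/-- The component of degree `h` of `p • v` for homogeneous `v` lies in every submodule that contains
the monomial multiples of `v` of degree `h`. -/
theorem IsGradedBy.proj_smul_mem (hgr : IsGradedBy 𝒱 π)
    (hX : ∀ s g v, v ∈ 𝒱 g → (X s : MvPolynomial σ K) • v ∈ 𝒱 (g + w s))
    (hC : ∀ (a : K) g v, v ∈ 𝒱 g → (C a : MvPolynomial σ K) • v ∈ 𝒱 g)
    {g h : G} {v : V} (hv : v ∈ 𝒱 g) (N : AddSubgroup V)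
    (hN : ∀ (α : σ →₀ ℕ) (a : K), g + Finsupp.weight w α = h →
      (C a : MvPolynomial σ K) • (monomial α (1 : K)) • v ∈ N)
    (p : MvPolynomial σ K) : π h (p • v) ∈ N := by
  rw [smul_eq_sum_monomial_smul, map_sum]
  refine sum_mem fun α _ => ?_
  have h1 := hC (p.coeff α) _ _ (monomial_smul_mem_graded hX hv α)
  by_cases hα : g + Finsupp.weight w α = h
  · rw [hα] at h1
    rw [hgr.self _ _ h1]
    exact hN α _ hα
  · rw [hgr.other _ _ _ h1 hα]
    exact zero_mem _

/-- The set of degrees `g` in which the graded subquotient `Z / B` is nonzero is a finite union of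
shifted monoids generated by degrees of variables that do not annihilate `Z / B`. -/
theorem exists_finite_support_description [Finite σ] [Module.Finite (MvPolynomial σ K) V]
    (hgr : IsGradedBy 𝒱 π)
    (hX : ∀ s g v, v ∈ 𝒱 g → (X s : MvPolynomial σ K) • v ∈ 𝒱 (g + w s))
    (hC : ∀ (a : K) g v, v ∈ 𝒱 g → (C a : MvPolynomial σ K) • v ∈ 𝒱 g)
    (B Z : Submodule (MvPolynomial σ K) V) (hBZ : B ≤ Z)
    (hB : ∀ g v, v ∈ B → π g v ∈ B) (hZ : ∀ g v, v ∈ Z → π g v ∈ Z) :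
    ∃ F : Set (G × Set σ), F.Finite ∧
      (∀ q ∈ F, ∀ s ∈ q.2, ∃ v ∈ Z, (X s : MvPolynomial σ K) • v ∉ B) ∧
      ∀ g, (∃ v ∈ 𝒱 g, v ∈ Z ∧ v ∉ B) ↔
        ∃ q ∈ F, ∃ α : σ →₀ ℕ, (∀ s, α s ≠ 0 → s ∈ q.2) ∧ g = q.1 + Finsupp.weight w α := by
  -- Noetherian induction: a maximal graded `N` between `B` and `Z` for which the description holds
  -- must be `Z`.
  let P : Submodule (MvPolynomial σ K) V → Prop := fun N =>
    B ≤ N ∧ N ≤ Z ∧ (∀ g v, v ∈ N → π g v ∈ N) ∧ ∃ F : Set (G × Set σ), F.Finite ∧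
      (∀ q ∈ F, ∀ s ∈ q.2, ∃ v ∈ Z, (X s : MvPolynomial σ K) • v ∉ B) ∧
      ∀ g, (∃ v ∈ 𝒱 g, v ∈ N ∧ v ∉ B) ↔
        ∃ q ∈ F, ∃ α : σ →₀ ℕ, (∀ s, α s ≠ 0 → s ∈ q.2) ∧ g = q.1 + Finsupp.weight w α
  have hPB : P B := ⟨le_rfl, hBZ, hB, ∅, Set.finite_empty, by simp, by
    intro g
    constructor
    · rintro ⟨v, -, h1, h2⟩
      exact absurd h1 h2
    · rintro ⟨q, hq, -⟩
      exact absurd hq (Set.notMem_empty q)⟩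
  have : IsNoetherian (MvPolynomial σ K) V := isNoetherian_of_isNoetherianRing_of_finite _ _
  obtain ⟨N, hPN, hmax⟩ := WellFounded.has_min
    (wellFounded_gt : WellFounded ((· > ·) : Submodule (MvPolynomial σ K) V → _ → Prop))
    {N | P N} ⟨B, hPB⟩
  obtain ⟨hBN, hNZ, hNhom, F, hFfin, hFvar, hF⟩ := hPN
  by_cases hNeq : N = Z
  · subst hNeq
    exact ⟨F, hFfin, hFvar, hF⟩
  exfalso
  -- a homogeneous element of `Z` outside `N` whose annihilator modulo `N` is maximal
  let col : V → Submodule (MvPolynomial σ K) (MvPolynomial σ K) := fun v =>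
    N.comap (LinearMap.toSpanSingleton (MvPolynomial σ K) V v)
  have hcol : ∀ v p, p ∈ col v ↔ p • v ∈ N := fun v p => by simp [col]
  let E : Set V := {v | v ∈ Z ∧ v ∉ N ∧ ∃ g, v ∈ 𝒱 g}
  have hE : E.Nonempty := by
    by_contra hne
    refine hNeq (le_antisymm hNZ fun x hx => ?_)
    refine hgr.closed x N.toAddSubgroup fun g => ?_
    by_contra hg
    exact hne ⟨π g x, hZ g x hx, hg, g, hgr.mem g x⟩
  obtain ⟨_, ⟨v, hvE, rfl⟩, hvmax⟩ := WellFounded.has_min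
    (wellFounded_gt : WellFounded
      ((· > ·) : Submodule (MvPolynomial σ K) (MvPolynomial σ K) → _ → Prop))
    (col '' E) (hE.image col)
  obtain ⟨hvZ, hvN, g₀, hvg⟩ := id hvE
  -- By maximality of the colon ideal `(N : v)`, multiplying `v` by a variable in `J` does not
  -- change it. So monomials in `J` never carry `v` into `N`, while any monomial involving another
  -- variable does.
  let J : Set σ := {s | (X s : MvPolynomial σ K) • v ∉ N}
  have hstep : ∀ y ∈ E, col y = col v → ∀ s ∈ J, (X s : MvPolynomial σ K) • y ∈ E ∧
      col ((X s : MvPolynomial σ K) • y) = col v := by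
    intro y hy hyv s hs
    have h1 : (X s : MvPolynomial σ K) • y ∉ N := by
      rw [← hcol, hyv, hcol]
      exact hs
    obtain ⟨hyZ, hyN, g, hyg⟩ := hy
    have h2 : (X s : MvPolynomial σ K) • y ∈ E := ⟨Z.smul_mem _ hyZ, h1, _, hX s g y hyg⟩
    refine ⟨h2, ?_⟩
    have h3 : col v ≤ col ((X s : MvPolynomial σ K) • y) := by
      intro p hp
      rw [← hyv, hcol] at hp
      rw [hcol, smul_comm]
      exact N.smul_mem _ hp
    by_contra hne
    exact hvmax _ ⟨_, h2, rfl⟩ (lt_of_le_of_ne h3 (Ne.symm hne))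
  have hmon : ∀ α : σ →₀ ℕ, (∀ s, α s ≠ 0 → s ∈ J) → ∀ y ∈ E, col y = col v →
      (monomial α (1 : K)) • y ∈ E ∧ col ((monomial α (1 : K)) • y) = col v := by
    intro α
    induction α using Finsupp.induction_linear with
    | zero => intro _ y hy hyv; simpa using ⟨hy, hyv⟩
    | add α β ha hb =>
      intro hJ y hy hyv
      have h : (monomial (α + β) (1 : K)) = monomial β 1 * monomial α 1 := by
        rw [monomial_mul, one_mul, add_comm]
      rw [h, mul_smul]
      obtain ⟨h1, h2⟩ := ha (fun s hs => hJ s (by simp [hs])) y hy hyv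
      exact hb (fun s hs => hJ s (by simp [hs])) _ h1 h2
    | single s k =>
      induction k with
      | zero => intro _ y hy hyv; simpa using ⟨hy, hyv⟩
      | succ k ih =>
        intro hJ y hy hyv
        have hs : s ∈ J := hJ s (by simp)
        have h : (monomial (Finsupp.single s (k + 1)) (1 : K)) =
            X s * monomial (Finsupp.single s k) 1 := by
          rw [X, monomial_mul, one_mul, add_comm, ← Finsupp.single_add]
        rw [h, mul_smul]
        obtain ⟨h1, h2⟩ := ih (fun t ht => by
          have : t = s := by
            by_contra hne
            exact ht (Finsupp.single_eq_of_ne hne)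
          exact this ▸ hs) y hy hyv
        exact hstep _ h1 h2 s hs
  have hkill : ∀ α : σ →₀ ℕ, (¬ ∀ s, α s ≠ 0 → s ∈ J) → (monomial α (1 : K)) • v ∈ N := by
    intro α hα
    push Not at hα
    obtain ⟨s, hs, hsJ⟩ := hα
    have h : (monomial α (1 : K)) = monomial (α - Finsupp.single s 1) 1 * X s := by
      rw [X, monomial_mul, one_mul, tsub_add_cancel_of_le]
      rw [Finsupp.single_le_iff]
      omega
    rw [h, mul_smul]
    exact N.smul_mem _ (not_not.mp hsJ)
  let N' := N ⊔ Submodule.span (MvPolynomial σ K) {v}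
  have hNN' : N ≤ N' := le_sup_left
  -- Adjoining `v` adds exactly the degrees `g₀ + ⟨w s : s ∈ J⟩`, so `N'` contradicts the maximality
  -- of `N`.
  have hvN' : v ∈ N' := le_sup_right (a := N) (Submodule.mem_span_singleton_self v)
  refine hmax N' ⟨hBN.trans hNN', sup_le hNZ ?_, ?_, insert (g₀, J) F, hFfin.insert _, ?_, ?_⟩
    (lt_of_le_of_ne hNN' fun h => hvN (h ▸ hvN'))
  · rw [Submodule.span_singleton_le_iff_mem]
    exact hvZ
  · intro g x hx
    obtain ⟨y, hy, z, hz, rfl⟩ := Submodule.mem_sup.mp hx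
    obtain ⟨p, rfl⟩ := Submodule.mem_span_singleton.mp hz
    rw [map_add]
    refine N'.add_mem (hNN' (hNhom g y hy)) ?_
    exact hgr.proj_smul_mem hX hC hvg N'.toAddSubgroup
      (fun α a _ => N'.smul_mem _ (N'.smul_mem _ hvN')) p
  · intro q hq s hs
    rcases Set.mem_insert_iff.mp hq with rfl | hq
    · exact ⟨v, hvZ, fun h => hs (hBN h)⟩
    · exact hFvar q hq s hs
  · intro g
    constructor
    · rintro ⟨x, hxg, hx, hxB⟩
      by_cases hα : ∃ α : σ →₀ ℕ, (∀ s, α s ≠ 0 → s ∈ J) ∧ g = g₀ + Finsupp.weight w α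
      · exact ⟨_, Set.mem_insert _ _, hα⟩
      -- In a degree outside the new shifted monoid, every monomial multiple of `v` lies in `N`.
      · have hxN : x ∈ N := by
          rw [← hgr.self _ _ hxg]
          obtain ⟨y, hy, z, hz, rfl⟩ := Submodule.mem_sup.mp hx
          obtain ⟨p, rfl⟩ := Submodule.mem_span_singleton.mp hz
          rw [map_add]
          refine N.add_mem (hNhom g y hy) ?_
          exact hgr.proj_smul_mem hX hC hvg N.toAddSubgroup
            (fun α a h => N.smul_mem _ (hkill α fun h' => hα ⟨α, h', h.symm⟩)) p
        obtain ⟨q, hq, hq'⟩ := (hF g).mp ⟨x, hxg, hxN, hxB⟩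
        exact ⟨q, Set.mem_insert_of_mem _ hq, hq'⟩
    · rintro ⟨q, hq, α, hα, rfl⟩
      rcases Set.mem_insert_iff.mp hq with rfl | hq
      · refine ⟨(monomial α (1 : K)) • v, monomial_smul_mem_graded hX hvg α,
          N'.smul_mem _ hvN', fun h => ?_⟩
        exact (hmon α hα v hvE rfl).1.2.1 (hBN h)
      · obtain ⟨x, hxg, hxN, hxB⟩ := (hF _).mpr ⟨q, hq, α, hα, rfl⟩
        exact ⟨x, hxg, hNN' hxN, hxB⟩

end Support

/-! ### Graded modules over the standard graded polynomial ring -/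

section Restrict

theorem IsGradedBy.restrict {G G' M N : Type*} [AddCommGroup M] [AddCommGroup N]
    {ℳ : G → AddSubgroup M} {π : G → M →+ M} (h : IsGradedBy ℳ π) {f : N →+ M}
    (hf : Function.Injective f) {φ : G' → G} (hφ : Function.Injective φ) {ρ : G' → N →+ N}
    (hρ : ∀ g x, f (ρ g x) = π (φ g) (f x)) (h0 : ∀ g x, g ∉ Set.range φ → π g (f x) = 0) :
    IsGradedBy (fun g => (ℳ (φ g)).comap f) ρ where
  mem g x := by
    rw [AddSubgroup.mem_comap, hρ]
    exact h.mem _ _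
  self g x hx := hf (by rw [hρ, h.self _ _ hx])
  other g g' x hx hg := hf (by rw [hρ, h.other _ _ _ hx fun e => hg (hφ e), map_zero])
  closed x H hH := by
    have : f x ∈ H.map f := by
      refine h.closed _ _ fun g => ?_
      by_cases hg : g ∈ Set.range φ
      · obtain ⟨g, rfl⟩ := hg
        exact ⟨ρ g x, hH g, hρ g x⟩
      · rw [h0 g x hg]
        exact zero_mem _
    obtain ⟨y, hy, hyx⟩ := this
    exact hf hyx ▸ hy

theorem IsGradedBy.pi {G M ι : Type*} [AddCommGroup G] [Fintype ι] [AddCommGroup M]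
    {ℳ : G → AddSubgroup M} {π : G → M →+ M} (h : IsGradedBy ℳ π) (shift : ι → G)
    {𝒬 : G → AddSubgroup (ι → M)} {ρ : G → (ι → M) →+ (ι → M)}
    (hQ : ∀ g v, v ∈ 𝒬 g ↔ ∀ l, v l ∈ ℳ (g - shift l))
    (hρ : ∀ g v l, ρ g v l = π (g - shift l) (v l)) : IsGradedBy 𝒬 ρ where
  mem g v := (hQ _ _).mpr fun l => by
    rw [hρ]
    exact h.mem _ _
  self g v hv := by
    ext l
    rw [hρ]
    exact h.self _ _ ((hQ _ _).mp hv l)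
  other g g' v hv hg := by
    ext l
    rw [hρ]
    exact h.other _ _ _ ((hQ _ _).mp hv l) fun e => hg (sub_left_injective e)
  closed v N hN := by
    classical
    choose s hs using fun l => h.exists_sum (v l)
    have hv : v = ∑ g ∈ Finset.univ.biUnion fun l => (s l).image (· + shift l), ρ g v := by
      ext l
      simp only [Finset.sum_apply, hρ]
      rw [← Finset.sum_image (f := fun g => π g (v l)) (g := fun g => g - shift l)
        (fun a _ b _ e => sub_left_injective e)]
      refine (hs l _ fun g hg => ?_).symm
      refine Finset.mem_image.mpr ⟨g + shift l, Finset.mem_biUnion.mpr ⟨l, Finset.mem_univ l, ?_⟩,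
        add_sub_cancel_right _ _⟩
      exact Finset.mem_image_of_mem _ hg
    rw [hv]
    exact sum_mem fun g _ => hN g

end Restrict

/-! ### Graded free modules and their homogeneous maps -/

section FreeModule

open MvPolynomial

variable {K : Type*} [Field K] {n : ℕ}

/-- `M` is a graded module over the standard graded ring `K[x₁, …, xₙ]`, with components `ℳ j` and
projections `π j`. -/
structure IsGradedPolyModule (K : Type*) [Field K] (n : ℕ) {M : Type*} [AddCommGroup M]
    [Module (MvPolynomial (Fin n) K) M] (ℳ : ℤ → AddSubgroup M) (π : ℤ → M →+ M) : Prop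
    extends IsGradedBy ℳ π where
  X_smul : ∀ (l : Fin n) j m, m ∈ ℳ j → (X l : MvPolynomial (Fin n) K) • m ∈ ℳ (j + 1)
  C_smul : ∀ (a : K) j m, m ∈ ℳ j → (C a : MvPolynomial (Fin n) K) • m ∈ ℳ j

theorem isGradedBy_polynomial {G σ : Type*} [AddCommGroup G] (w : σ → G) :
    IsGradedBy (fun g => (weightedHomogeneousSubmodule K w g).toAddSubgroup)
      (fun g => (weightedHomogeneousComponent w g : MvPolynomial σ K →ₗ[K] _).toAddMonoidHom) where
  mem g p := weightedHomogeneousComponent_isWeightedHomogeneous g p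
  self g p hp := by
    classical
    exact (weightedHomogeneousComponent_of_mem hp).trans (if_pos rfl)
  other g g' p hp hg := by
    classical
    exact (weightedHomogeneousComponent_of_mem hp).trans (if_neg hg.symm)
  closed p N hN := by
    rw [← sum_weightedHomogeneousComponent w p]
    exact finsum_induction (· ∈ N) N.zero_mem (fun _ _ => N.add_mem) hN

/-- The grading of the free module `⨁ₖ R(-shift k)`. -/
def freeGrading (K : Type*) [Field K] (n : ℕ) {r : ℕ} (shift : Fin r → ℤ) (j : ℤ) :
    AddSubgroup (Fin r → MvPolynomial (Fin n) K) where
  carrier := {v | ∀ l, IsWeightedHomogeneous (fun _ : Fin n => (1 : ℤ)) (v l) (j - shift l)}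
  zero_mem' _ := isWeightedHomogeneous_zero K _ _
  add_mem' hv hw l := (hv l).add (hw l)
  neg_mem' hv l := (weightedHomogeneousSubmodule K (fun _ : Fin n => (1 : ℤ)) _).neg_mem (hv l)

/-- The projections belonging to `freeGrading`. -/
noncomputable def freeProj (K : Type*) [Field K] (n : ℕ) {r : ℕ} (shift : Fin r → ℤ) (j : ℤ) :
    (Fin r → MvPolynomial (Fin n) K) →+ (Fin r → MvPolynomial (Fin n) K) where
  toFun v l := weightedHomogeneousComponent (fun _ : Fin n => (1 : ℤ)) (j - shift l) (v l)
  map_zero' := by ext1 l; simp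
  map_add' v w := by ext1 l; simp

theorem isGradedPolyModule_free {r : ℕ} (shift : Fin r → ℤ) :
    IsGradedPolyModule K n (freeGrading K n shift) (freeProj K n shift) where
  toIsGradedBy := (isGradedBy_polynomial (K := K) (fun _ : Fin n => (1 : ℤ))).pi shift
    (fun _ _ => Iff.rfl) (fun _ _ _ => rfl)
  X_smul l j v hv k := by
    have := (isWeightedHomogeneous_X K (fun _ : Fin n => (1 : ℤ)) l).mul (hv k)
    rwa [show 1 + (j - shift k) = j + 1 - shift k by ring] at this
  C_smul a j v hv k := by
    have := (isWeightedHomogeneous_C (fun _ : Fin n => (1 : ℤ)) a).mul (hv k)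
    rwa [zero_add] at this

section

variable {M : Type*} [AddCommGroup M] [Module (MvPolynomial (Fin n) K) M]
  {ℳ : ℤ → AddSubgroup M} {π : ℤ → M →+ M}

theorem IsGradedPolyModule.homogeneous_smul (h : IsGradedPolyModule K n ℳ π)
    {p : MvPolynomial (Fin n) K} {e j : ℤ} {v : M}
    (hp : IsWeightedHomogeneous (fun _ : Fin n => (1 : ℤ)) p e) (hv : v ∈ ℳ j) :
    p • v ∈ ℳ (j + e) := by
  rw [smul_eq_sum_monomial_smul]
  refine sum_mem fun α hα => ?_
  rw [← hp (mem_support_iff.mp hα)]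
  exact h.C_smul _ _ _ (monomial_smul_mem_graded h.X_smul hv α)

theorem IsGradedPolyModule.map_free_mem (h : IsGradedPolyModule K n ℳ π) {r : ℕ} {shift : Fin r → ℤ}
    {ε : (Fin r → MvPolynomial (Fin n) K) →ₗ[MvPolynomial (Fin n) K] M}
    (hε : ∀ k, ε (Pi.single k 1) ∈ ℳ (shift k)) {j : ℤ} {v : Fin r → MvPolynomial (Fin n) K}
    (hv : v ∈ freeGrading K n shift j) : ε v ∈ ℳ j := by
  rw [LinearMap.pi_apply_eq_sum_univ ε v]
  refine sum_mem fun k _ => ?_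
  have h1 := h.homogeneous_smul (hv k) (hε k)
  rw [add_sub_cancel] at h1
  convert h1 using 3
  ext1 l
  simp [Pi.single_apply, eq_comm]

theorem IsGradedPolyModule.proj_map_free (h : IsGradedPolyModule K n ℳ π) {r : ℕ}
    {shift : Fin r → ℤ} {ε : (Fin r → MvPolynomial (Fin n) K) →ₗ[MvPolynomial (Fin n) K] M}
    (hε : ∀ k, ε (Pi.single k 1) ∈ ℳ (shift k)) (j : ℤ) (v : Fin r → MvPolynomial (Fin n) K) :
    π j (ε v) = ε (freeProj K n shift j v) :=
  (isGradedPolyModule_free (K := K) (n := n) shift).proj_map h.toIsGradedBy Function.injective_id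
    ε.toAddMonoidHom (fun _ _ hv => h.map_free_mem hε hv) j v

/-- Any preimage may be replaced by its component of degree `j`. -/
theorem IsGradedPolyModule.exists_lift (h : IsGradedPolyModule K n ℳ π) {r : ℕ}
    {shift : Fin r → ℤ} {ε : (Fin r → MvPolynomial (Fin n) K) →ₗ[MvPolynomial (Fin n) K] M}
    (hε : ∀ k, ε (Pi.single k 1) ∈ ℳ (shift k)) (hsurj : Function.Surjective ε) {j : ℤ} {m : M}
    (hm : m ∈ ℳ j) : ∃ v ∈ freeGrading K n shift j, ε v = m := by
  obtain ⟨v, rfl⟩ := hsurj m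
  refine ⟨freeProj K n shift j v, (isGradedPolyModule_free shift).mem j v, ?_⟩
  rw [← h.proj_map_free hε, h.self _ _ hm]

/-- The grading induced on a submodule. -/
noncomputable def submoduleGrading (ℳ : ℤ → AddSubgroup M) (N : Submodule (MvPolynomial (Fin n) K) M) (j : ℤ) :
    AddSubgroup N :=
  (ℳ j).comap N.subtype.toAddMonoidHom

/-- The projections belonging to `submoduleGrading`. -/
noncomputable def submoduleProj (π : ℤ → M →+ M) (N : Submodule (MvPolynomial (Fin n) K) M)
    (hN : ∀ j, ∀ x ∈ N, π j x ∈ N) (j : ℤ) : N →+ N where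
  toFun x := ⟨π j x, hN j x x.2⟩
  map_zero' := by ext; simp
  map_add' x y := by ext; simp

theorem IsGradedPolyModule.submodule (h : IsGradedPolyModule K n ℳ π)
    (N : Submodule (MvPolynomial (Fin n) K) M) (hN : ∀ j, ∀ x ∈ N, π j x ∈ N) :
    IsGradedPolyModule K n (submoduleGrading ℳ N) (submoduleProj π N hN) where
  toIsGradedBy := h.restrict (f := N.subtype.toAddMonoidHom) N.injective_subtype
    (φ := id) Function.injective_id (fun _ _ => rfl) (fun g _ hg => absurd ⟨g, rfl⟩ hg)
  X_smul l j m hm := h.X_smul l j m hm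
  C_smul a j m hm := h.C_smul a j m hm

theorem IsGradedPolyModule.proj_mem_ker (h : IsGradedPolyModule K n ℳ π) {r : ℕ}
    {shift : Fin r → ℤ} {ε : (Fin r → MvPolynomial (Fin n) K) →ₗ[MvPolynomial (Fin n) K] M}
    (hε : ∀ k, ε (Pi.single k 1) ∈ ℳ (shift k)) (j : ℤ) :
    ∀ v ∈ LinearMap.ker ε, freeProj K n shift j v ∈ LinearMap.ker ε := by
  intro v hv
  rw [LinearMap.mem_ker, ← h.proj_map_free hε, LinearMap.mem_ker.mp hv, map_zero]

/-- The induced grading on the kernel of a homogeneous map from a free module. -/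
theorem IsGradedPolyModule.ker (h : IsGradedPolyModule K n ℳ π) {r : ℕ}
    {shift : Fin r → ℤ} {ε : (Fin r → MvPolynomial (Fin n) K) →ₗ[MvPolynomial (Fin n) K] M}
    (hε : ∀ k, ε (Pi.single k 1) ∈ ℳ (shift k)) :
    IsGradedPolyModule K n (submoduleGrading (freeGrading K n shift) (LinearMap.ker ε))
      (submoduleProj (freeProj K n shift) (LinearMap.ker ε) (h.proj_mem_ker hε)) :=
  (isGradedPolyModule_free shift).submodule _ _

theorem IsGradedPolyModule.proj_X_smul (h : IsGradedPolyModule K n ℳ π) (l : Fin n) (j : ℤ)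
    (m : M) : π (j + 1) ((X l : MvPolynomial (Fin n) K) • m) = (X l : MvPolynomial (Fin n) K) • π j m :=
  h.proj_map h.toIsGradedBy (φ := (· + 1)) (add_left_injective 1)
    (DistribSMul.toAddMonoidHom M (X l : MvPolynomial (Fin n) K)) (fun j m hm => h.X_smul l j m hm)
    j m

end

theorem notMem_span_range_X_iff {σ : Type*} {p : MvPolynomial σ K} :
    p ∉ Ideal.span (Set.range (X : σ → MvPolynomial σ K)) ↔ p.coeff 0 ≠ 0 := by
  rw [← Set.image_univ, mem_ideal_span_X_image]
  constructor
  · intro hp h0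
    refine hp fun m hm => ?_
    have hm0 : m ≠ 0 := by
      rintro rfl
      exact mem_support_iff.mp hm h0
    obtain ⟨i, hi⟩ := DFunLike.ne_iff.mp hm0
    exact ⟨i, Set.mem_univ i, hi⟩
  · intro h hp
    obtain ⟨i, -, hi⟩ := hp 0 (mem_support_iff.mpr h)
    exact hi rfl

theorem exists_sum_X_smul {r : ℕ} (v : Fin r → MvPolynomial (Fin n) K)
    (hv : ∀ k, v k ∈ Ideal.span (Set.range (X : Fin n → MvPolynomial (Fin n) K))) :
    ∃ y : Fin n → Fin r → MvPolynomial (Fin n) K,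
      ∑ l, (X l : MvPolynomial (Fin n) K) • y l = v := by
  have h : ∀ k, ∃ y : Fin n → MvPolynomial (Fin n) K, ∑ l, X l * y l = v k := by
    intro k
    obtain ⟨y, hy⟩ := (Submodule.mem_span_range_iff_exists_fun _).mp (hv k)
    exact ⟨y, by simpa [mul_comm] using hy⟩
  choose y hy using h
  refine ⟨fun l k => y k l, ?_⟩
  ext1 k
  simpa using hy k

end FreeModule

/-! ### Betti numbers and Koszul homology -/

section BettiKoszul

open MvPolynomial

variable {K : Type*} [Field K] {n : ℕ} {M : Type*} [AddCommGroup M]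
  [Module (MvPolynomial (Fin n) K) M] {ℳ : ℤ → AddSubgroup M} {π : ℤ → M →+ M} {r : ℕ}
  {shift : Fin r → ℤ} {ε : (Fin r → MvPolynomial (Fin n) K) →ₗ[MvPolynomial (Fin n) K] M}

/-- The homology in degree zero is `M / (x) M`, which equals `F / (x) F` because the kernel of `ε`
lies in `(x) F`. -/
theorem koszulHomologyNonzero_zero_iff (h : IsGradedPolyModule K n ℳ π)
    (hε : ∀ k, ε (Pi.single k 1) ∈ ℳ (shift k)) (hsurj : Function.Surjective ε)
    (hmin : ∀ v, ε v = 0 → ∀ k, v k ∈ Ideal.span (Set.range (X : Fin n → MvPolynomial (Fin n) K)))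
    (j : ℤ) :
    KoszulHomologyNonzero (X : Fin n → MvPolynomial (Fin n) K) ℳ 1 (0, j) ↔ ∃ k, shift k = j := by
  constructor
  · rintro ⟨c, hc, -, hcb⟩
    have hj : c ∅ ∈ ℳ j := by simpa using (hc ∅).2
    obtain ⟨v, hv, hvc⟩ := h.exists_lift hε hsurj hj
    by_contra hne
    push Not at hne
    -- Without a basis element of degree `j`, no coordinate of `v` has degree zero, so all constant
    -- terms vanish.
    obtain ⟨y, hy⟩ := exists_sum_X_smul v fun k => by
      by_contra hk
      rw [notMem_span_range_X_iff] at hk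
      have := hv k hk
      rw [map_zero] at this
      exact hne k (by linarith)
    refine hcb (koszulOne Finset.univ fun l => ε (y l)) ?_
    ext1 I
    by_cases hI : I = ∅
    · subst hI
      rw [koszulDiff_one_empty, ← hvc, ← hy, map_sum]
      simp
    · rw [koszulDiff_one_of_ne _ _ _ hI, (hc I).1]
      simpa using hI
  · rintro ⟨k, rfl⟩
    refine ⟨Pi.single ∅ (ε (Pi.single k 1)), fun I => ?_, ?_, fun b hb => ?_⟩
    · by_cases hI : I = ∅
      · subst hI
        simpa using hε k
      · rw [Pi.single_eq_of_ne hI]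
        exact ⟨fun _ => rfl, zero_mem _⟩
    · rw [koszulDiff_congr (c' := 0), map_zero]
      exact fun I hI => by rw [Pi.single_eq_of_ne hI]; rfl
    · have h1 := congrFun hb ∅
      rw [koszulDiff_empty_apply, Pi.single_eq_same] at h1
      choose f hf using fun l => hsurj (b {l})
      have h2 := hmin (Pi.single k 1 - ∑ l, (X l : MvPolynomial (Fin n) K) • f l) (by
        simp [map_sub, map_sum, hf, h1]) k
      have h3 : (∑ l, (X l : MvPolynomial (Fin n) K) • f l) k ∈
          Ideal.span (Set.range (X : Fin n → MvPolynomial (Fin n) K)) := by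
        rw [Finset.sum_apply]
        exact sum_mem fun l _ => Ideal.mul_mem_right _ _ (Ideal.subset_span ⟨l, rfl⟩)
      have h4 := add_mem h2 h3
      rw [Pi.sub_apply, sub_add_cancel, Pi.single_eq_same] at h4
      exact notMem_span_range_X_iff.mpr (by simp) h4

/-- Dimension shifting along `0 → ker ε → F → M → 0`. The connecting map is bijective because the
Koszul complex of `F` is exact in positive degrees and, for `i = 0`, because `H_0(ker ε) → H_0(F)`
vanishes by minimality. -/
theorem koszulHomologyNonzero_succ_iff (h : IsGradedPolyModule K n ℳ π)
    (hε : ∀ k, ε (Pi.single k 1) ∈ ℳ (shift k)) (hsurj : Function.Surjective ε)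
    (hmin : ∀ v, ε v = 0 → ∀ k, v k ∈ Ideal.span (Set.range (X : Fin n → MvPolynomial (Fin n) K)))
    (i : ℕ) (j : ℤ) :
    KoszulHomologyNonzero (X : Fin n → MvPolynomial (Fin n) K) ℳ 1 ((i : ℤ) + 1, j) ↔
      KoszulHomologyNonzero (X : Fin n → MvPolynomial (Fin n) K)
        (submoduleGrading (freeGrading K n shift) (LinearMap.ker ε)) 1 ((i : ℤ), j) := by
  have hF := isGradedPolyModule_free (K := K) (n := n) shift
  have hdε : ∀ (c : Finset (Fin n) → Fin r → MvPolynomial (Fin n) K) I,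
      koszulDiff (X : Fin n → MvPolynomial (Fin n) K) M Finset.univ (fun I => ε (c I)) I =
        ε (koszulDiff X _ Finset.univ c I) := fun c I => koszulDiff_comp _ _ ε c I
  have hdι : ∀ (c : Finset (Fin n) → LinearMap.ker ε) I,
      koszulDiff (X : Fin n → MvPolynomial (Fin n) K) _ Finset.univ
        (fun I => (c I : Fin r → MvPolynomial (Fin n) K)) I = koszulDiff X _ Finset.univ c I :=
    fun c I => koszulDiff_comp _ _ (LinearMap.ker ε).subtype c I
  constructor
  · rintro ⟨c, hc, hdc, hcb⟩
    have hlift : ∀ I, ∃ v : Fin r → MvPolynomial (Fin n) K, ε v = c I ∧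
        v ∈ freeGrading K n shift (j - ((i : ℤ) + 1) • 1) ∧
        ((I.card : ℤ) ≠ (i : ℤ) + 1 → v = 0) := by
      intro I
      by_cases hI : (I.card : ℤ) = (i : ℤ) + 1
      · obtain ⟨v, hv, hvc⟩ := h.exists_lift hε hsurj (hc I).2
        exact ⟨v, hvc, hv, fun h => absurd hI h⟩
      · exact ⟨0, by rw [map_zero, (hc I).1 hI], zero_mem _, fun _ => rfl⟩
    -- The connecting map: lift the cycle homogeneously to `F` and apply the differential.
    choose v hvc hvF hv0 using hlift
    have hv : v ∈ koszulGrading n (freeGrading K n shift) 1 ((i : ℤ) + 1, j) :=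
      fun I => ⟨hv0 I, hvF I⟩
    have hdv := koszulDiff_mem_koszulGrading hF.X_smul hv
    have hker : ∀ I, koszulDiff (X : Fin n → MvPolynomial (Fin n) K) _ Finset.univ v I ∈
        LinearMap.ker ε := by
      intro I
      rw [LinearMap.mem_ker, ← hdε]
      simp only [hvc]
      exact congrFun hdc I
    refine ⟨fun I => ⟨_, hker I⟩, fun I => ⟨fun hI => Subtype.ext ((hdv I).1 hI), (hdv I).2⟩,
      ?_, fun ω hω => ?_⟩
    · ext1 I
      refine Subtype.ext ?_
      rw [← hdι]
      exact congrFun (koszulDiff_diff _ _ v) I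
    -- Exactness on `F` is available for chains vanishing at `∅`; clearing that entry does not
    -- affect the boundary.
    · let ω' : Finset (Fin n) → Fin r → MvPolynomial (Fin n) K :=
        fun I => if I = ∅ then 0 else ω I
      have hω' : koszulDiff (X : Fin n → MvPolynomial (Fin n) K)
          (Fin r → MvPolynomial (Fin n) K) Finset.univ ω' =
          koszulDiff (X : Fin n → MvPolynomial (Fin n) K) _ Finset.univ v := by
        have h1 : koszulDiff (X : Fin n → MvPolynomial (Fin n) K)
            (Fin r → MvPolynomial (Fin n) K) Finset.univ ω' =
            koszulDiff (X : Fin n → MvPolynomial (Fin n) K) _ Finset.univ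
              fun I => (ω I : Fin r → MvPolynomial (Fin n) K) :=
          koszulDiff_congr _ _ fun I hI => if_neg hI
        rw [h1]
        ext1 I
        rw [hdι, hω]
      obtain ⟨f, hf⟩ := koszulDiff_exact_pi r (v - ω')
        (by
          rw [Pi.sub_apply, hv0 ∅ (by rw [Finset.card_empty]; push_cast; positivity)]
          simp [ω'])
        (by rw [map_sub, hω', sub_self])
      refine hcb (fun I => ε (f I)) ?_
      ext1 I
      rw [hdε, hf, Pi.sub_apply, map_sub, hvc]
      have : ε (ω' I) = 0 := by
        simp only [ω']
        split_ifs
        · exact map_zero ε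
        · exact (ω I).2
      rw [this, sub_zero]
  · rintro ⟨c, hc, hdc, hcb⟩
    let c' : Finset (Fin n) → Fin r → MvPolynomial (Fin n) K := fun I => c I
    have hc' : c' ∈ koszulGrading n (freeGrading K n shift) 1 ((i : ℤ), j) := fun I =>
      ⟨fun hI => by simp only [c', (hc I).1 hI]; rfl, (hc I).2⟩
    have hdc' : koszulDiff (X : Fin n → MvPolynomial (Fin n) K) _ Finset.univ c' = 0 := by
      ext1 I
      rw [hdι, hdc]
      rfl
    -- Minimality makes `c' ∅` a combination of the `x_l`; this corrects degree zero, and exactness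
    -- handles the rest.
    have hex : ∃ f, koszulDiff (X : Fin n → MvPolynomial (Fin n) K) _ Finset.univ f = c' := by
      obtain ⟨y, hy⟩ := exists_sum_X_smul (c' ∅) (hmin _ (c ∅).2)
      obtain ⟨f, hf⟩ := koszulDiff_exact_pi r
        (c' - koszulDiff (X : Fin n → MvPolynomial (Fin n) K) _ Finset.univ
          (koszulOne Finset.univ y))
        (by rw [Pi.sub_apply, koszulDiff_one_empty, hy, sub_self])
        (by rw [map_sub, hdc', koszulDiff_diff, sub_zero])
      exact ⟨f + koszulOne Finset.univ y, by rw [map_add, hf, sub_add_cancel]⟩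
    obtain ⟨f, hf⟩ := hex
    -- Passing to a component makes the preimage homogeneous without changing its boundary.
    let f' := koszulProj n (freeProj K n shift) 1 ((i : ℤ) + 1, j) f
    have hf' : koszulDiff (X : Fin n → MvPolynomial (Fin n) K) _ Finset.univ f' = c' := by
      rw [koszulDiff_proj hF.proj_X_smul, hf, (hF.toIsGradedBy.koszul n 1).self _ _ hc']
    have hf'g : f' ∈ koszulGrading n (freeGrading K n shift) 1 ((i : ℤ) + 1, j) :=
      (hF.toIsGradedBy.koszul n 1).mem _ _
    refine ⟨fun I => ε (f' I), fun I => ⟨fun hI => (congrArg ε ((hf'g I).1 hI)).trans (map_zero ε),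
      h.map_free_mem hε (hf'g I).2⟩, ?_, fun b hb => ?_⟩
    · ext1 I
      rw [hdε, hf']
      exact (c I).2
    · choose m hm using fun I => hsurj (b I)
      have hker : ∀ I, f' I - koszulDiff (X : Fin n → MvPolynomial (Fin n) K) _ Finset.univ m I ∈
          LinearMap.ker ε := by
        intro I
        rw [LinearMap.mem_ker, map_sub, ← hdε]
        simp only [hm]
        rw [hb, sub_self]
      refine hcb (fun I => ⟨_, hker I⟩) ?_
      ext1 I
      refine Subtype.ext ?_
      rw [← hdι]
      have := congrFun (map_sub (koszulDiff (X : Fin n → MvPolynomial (Fin n) K)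
        (Fin r → MvPolynomial (Fin n) K) Finset.univ) f'
        (koszulDiff (X : Fin n → MvPolynomial (Fin n) K) _ Finset.univ m)) I
      rw [koszulDiff_diff, sub_zero, hf'] at this
      exact this

/-- The resolution of the first syzygy module obtained by dropping the first free module. -/
noncomputable def MinimalGradedFreeResolution.tail (F : MinimalGradedFreeResolution (K := K) (n := n) ℳ) :
    MinimalGradedFreeResolution (K := K) (n := n)
      (submoduleGrading (freeGrading K n (F.shift 0)) (LinearMap.ker F.aug)) where
  rank i := F.rank (i + 1)
  shift i := F.shift (i + 1)
  diff i := F.diff (i + 1)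
  aug := (F.diff 0).codRestrict (LinearMap.ker F.aug) fun v =>
    (F.exact_zero _).mpr ⟨v, rfl⟩
  diff_homogeneous i := F.diff_homogeneous (i + 1)
  aug_homogeneous k := F.diff_homogeneous 0 k
  aug_surjective := by
    rintro ⟨v, hv⟩
    obtain ⟨u, hu⟩ := (F.exact_zero v).mp hv
    exact ⟨u, Subtype.ext hu⟩
  exact_zero v := by
    rw [← F.exact_succ 0 v]
    exact Subtype.ext_iff
  exact_succ i := F.exact_succ (i + 1)
  minimal i := F.minimal (i + 1)

theorem MinimalGradedFreeResolution.ker_aug_le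
    (F : MinimalGradedFreeResolution (K := K) (n := n) ℳ)
    (v : Fin (F.rank 0) → MvPolynomial (Fin n) K) (hv : F.aug v = 0) (k : Fin (F.rank 0)) :
    v k ∈ Ideal.span (Set.range (X : Fin n → MvPolynomial (Fin n) K)) := by
  obtain ⟨u, rfl⟩ := (F.exact_zero v).mp hv
  rw [LinearMap.pi_apply_eq_sum_univ (F.diff 0) u, Finset.sum_apply]
  refine sum_mem fun l _ => Ideal.mul_mem_left _ _ ?_
  convert F.minimal 0 l k using 3
  ext1 l
  simp [Pi.single_apply, eq_comm]

theorem MinimalGradedFreeResolution.exists_shift_zero_iff (h : IsGradedPolyModule K n ℳ π)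
    (F : MinimalGradedFreeResolution (K := K) (n := n) ℳ) (j : ℤ) :
    (∃ k, F.shift 0 k = j) ↔
      KoszulHomologyNonzero (X : Fin n → MvPolynomial (Fin n) K) ℳ 1 (0, j) :=
  (koszulHomologyNonzero_zero_iff h F.aug_homogeneous F.aug_surjective F.ker_aug_le j).symm

end BettiKoszul

section BettiKoszul

open MvPolynomial

universe u v

/-- The induction passes to the first syzygy module, which lives in the universe of `K`; hence `M`
is restricted to that universe here, and `exists_shift_iff` performs the first shift for general
`M`. -/
theorem MinimalGradedFreeResolution.exists_shift_iff_aux {K : Type u} [Field K] {n : ℕ} (i : ℕ)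
    (j : ℤ) : ∀ {M : Type u} [AddCommGroup M] [Module (MvPolynomial (Fin n) K) M]
      {ℳ : ℤ → AddSubgroup M} {π : ℤ → M →+ M} (_ : IsGradedPolyModule K n ℳ π)
      (F : MinimalGradedFreeResolution (K := K) (n := n) ℳ), (∃ k, F.shift i k = j) ↔
      KoszulHomologyNonzero (X : Fin n → MvPolynomial (Fin n) K) ℳ 1 ((i : ℤ), j) := by
  induction i with
  | zero => exact fun h F => F.exists_shift_zero_iff h j
  | succ i ih =>
    intro M _ _ ℳ π h F
    rw [Nat.cast_succ, koszulHomologyNonzero_succ_iff h F.aug_homogeneous F.aug_surjective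
      F.ker_aug_le]
    exact ih (h.ker F.aug_homogeneous) F.tail

/-- The degrees of the generators in a minimal graded free resolution are those in which the Koszul
homology is nonzero. -/
theorem MinimalGradedFreeResolution.exists_shift_iff {K : Type u} [Field K] {n : ℕ} {M : Type v}
    [AddCommGroup M] [Module (MvPolynomial (Fin n) K) M] {ℳ : ℤ → AddSubgroup M}
    {π : ℤ → M →+ M} (h : IsGradedPolyModule K n ℳ π)
    (F : MinimalGradedFreeResolution (K := K) (n := n) ℳ) (i : ℕ) (j : ℤ) :
    (∃ k, F.shift i k = j) ↔
      KoszulHomologyNonzero (X : Fin n → MvPolynomial (Fin n) K) ℳ 1 ((i : ℤ), j) := by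
  cases i with
  | zero => exact F.exists_shift_zero_iff h j
  | succ i =>
    rw [Nat.cast_succ, koszulHomologyNonzero_succ_iff h F.aug_homogeneous F.aug_surjective
      F.ker_aug_le]
    exact MinimalGradedFreeResolution.exists_shift_iff_aux i j (h.ker F.aug_homogeneous) F.tail

end BettiKoszul

/-! ### Existence of minimal graded free resolutions -/

section Existence

open MvPolynomial

variable {K : Type*} [Field K] {n : ℕ}

theorem weight_one_eq_zero_iff {σ : Type*} (α : σ →₀ ℕ) :
    Finsupp.weight (fun _ : σ => (1 : ℤ)) α = 0 ↔ α = 0 := by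
  refine ⟨fun h => ?_, fun h => by rw [h, map_zero]⟩
  rw [Finsupp.weight_apply, Finsupp.sum, Finset.sum_eq_zero_iff_of_nonneg] at h
  · ext s
    by_contra hs
    have := h s (Finsupp.mem_support_iff.mpr hs)
    simp at this
    exact hs this
  · intro s _
    simp

theorem weightedHomogeneousComponent_one_zero {σ : Type*} (p : MvPolynomial σ K) :
    weightedHomogeneousComponent (fun _ : σ => (1 : ℤ)) 0 p = C (p.coeff 0) := by
  classical
  ext α
  rw [coeff_weightedHomogeneousComponent, coeff_C]
  simp only [weight_one_eq_zero_iff]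
  by_cases hα : α = 0
  · simp [hα]
  · rw [if_neg hα, if_neg (Ne.symm hα)]

theorem IsGradedBy.exists_homogeneous_generators {A G M : Type*} [CommRing A] [AddCommGroup M]
    [Module A M] [Module.Finite A M] {ℳ : G → AddSubgroup M} {π : G → M →+ M}
    (h : IsGradedBy ℳ π) :
    ∃ (r : ℕ) (shift : Fin r → G) (m : Fin r → M), (∀ k, m k ∈ ℳ (shift k)) ∧
      Submodule.span A (Set.range m) = ⊤ := by
  have htop : Submodule.span A {x | ∃ g, x ∈ ℳ g} = ⊤ := by
    refine (Submodule.eq_top_iff').mpr fun x => ?_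
    exact h.closed x (Submodule.span A {x | ∃ g, x ∈ ℳ g}).toAddSubgroup fun g =>
      Submodule.subset_span ⟨g, h.mem g x⟩
  have hfg : (Submodule.span A {x | ∃ g, x ∈ ℳ g}).FG := htop ▸ Module.Finite.fg_top
  obtain ⟨s, hs, hspan⟩ := (Submodule.fg_span_iff_fg_span_finset_subset _).mp hfg
  choose shift hshift using fun k => hs (s.equivFin.symm k).2
  refine ⟨s.card, shift, fun k => s.equivFin.symm k, hshift, ?_⟩
  rw [← htop, hspan]
  congr 1
  ext x
  constructor
  · rintro ⟨k, rfl⟩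
    exact (s.equivFin.symm k).2
  · intro hx
    exact ⟨s.equivFin ⟨x, hx⟩, by simp⟩

variable {M : Type*} [AddCommGroup M] [Module (MvPolynomial (Fin n) K) M]
  {ℳ : ℤ → AddSubgroup M} {π : ℤ → M →+ M}

/-- A minimal system of homogeneous generators gives a surjection from a graded free module with
kernel in `(x₁, …, xₙ) F`. -/
theorem IsGradedPolyModule.exists_minimal_presentation
    [Module.Finite (MvPolynomial (Fin n) K) M] (h : IsGradedPolyModule K n ℳ π) :
    ∃ (r : ℕ) (shift : Fin r → ℤ)
      (ε : (Fin r → MvPolynomial (Fin n) K) →ₗ[MvPolynomial (Fin n) K] M),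
      (∀ k, ε (Pi.single k 1) ∈ ℳ (shift k)) ∧ Function.Surjective ε ∧
      ∀ v, ε v = 0 → ∀ k, v k ∈ Ideal.span (Set.range (X : Fin n → MvPolynomial (Fin n) K)) := by
  classical
  have hex : ∃ r, ∃ (shift : Fin r → ℤ) (m : Fin r → M), (∀ k, m k ∈ ℳ (shift k)) ∧
      Submodule.span (MvPolynomial (Fin n) K) (Set.range m) = ⊤ :=
    h.toIsGradedBy.exists_homogeneous_generators
  obtain ⟨shift, m, hm, hspan⟩ := Nat.find_spec hex
  have hmin := fun r => Nat.find_min hex (m := r)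
  generalize Nat.find hex = r at shift m hm hspan hmin
  have hε : ∀ k, Fintype.linearCombination (MvPolynomial (Fin n) K) m (Pi.single k 1) ∈
      ℳ (shift k) := fun k => by
    rw [Fintype.linearCombination_apply_single, one_smul]
    exact hm k
  refine ⟨r, shift, Fintype.linearCombination _ m, hε, ?_, ?_⟩
  · rw [← LinearMap.range_eq_top, Fintype.range_linearCombination, hspan]
  · intro v hv k
    by_contra hk
    rw [notMem_span_range_X_iff] at hk
    -- In the component of degree `shift k` of this relation, the coefficient of `m k` is a nonzero
    -- scalar. So `m k` is redundant, contradicting the minimal number of generators.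
    have hv' := h.proj_mem_ker hε (shift k) v hv
    have hvk : freeProj K n shift (shift k) v k = C ((v k).coeff 0) := by
      change weightedHomogeneousComponent _ (shift k - shift k) (v k) = _
      rw [sub_self, weightedHomogeneousComponent_one_zero]
    generalize freeProj K n shift (shift k) v = u at hv' hvk
    obtain _ | r := r
    · exact k.elim0
    refine hmin r (Nat.lt_succ_self r) ⟨shift ∘ k.succAbove, m ∘ k.succAbove,
      fun l => hm _, ?_⟩
    rw [LinearMap.mem_ker, Fintype.linearCombination_apply, Fin.sum_univ_succAbove _ k, hvk] at hv'
    have hmk : m k ∈ Submodule.span (MvPolynomial (Fin n) K) (Set.range (m ∘ k.succAbove)) := by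
      have h1 : (C ((v k).coeff 0) : MvPolynomial (Fin n) K) • m k ∈
          Submodule.span (MvPolynomial (Fin n) K) (Set.range (m ∘ k.succAbove)) := by
        rw [eq_neg_of_add_eq_zero_left hv']
        exact neg_mem (sum_mem fun l _ => Submodule.smul_mem _ _ (Submodule.subset_span ⟨l, rfl⟩))
      have h2 := Submodule.smul_mem _ (C ((v k).coeff 0)⁻¹ : MvPolynomial (Fin n) K) h1
      rwa [← mul_smul, ← C_mul, inv_mul_cancel₀ hk, C_1, one_smul] at h2
    rw [eq_top_iff, ← hspan, Submodule.span_le]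
    rintro _ ⟨l, rfl⟩
    by_cases hl : l = k
    · exact hl ▸ hmk
    · obtain ⟨l, rfl⟩ := Fin.exists_succAbove_eq hl
      exact Submodule.subset_span ⟨l, rfl⟩

variable (K n) in
/-- A graded submodule of `(x₁, …, xₙ) F` for a graded free module `F`. -/
structure GradedSyzygy where
  /-- the rank of `F` -/
  rank : ℕ
  /-- the degrees of the basis of `F` -/
  shift : Fin rank → ℤ
  /-- the submodule -/
  ker : Submodule (MvPolynomial (Fin n) K) (Fin rank → MvPolynomial (Fin n) K)
  proj_mem : ∀ j, ∀ v ∈ ker, freeProj K n shift j v ∈ ker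
  le : ∀ v ∈ ker, ∀ k, v k ∈ Ideal.span (Set.range (X : Fin n → MvPolynomial (Fin n) K))

/-- One step of the resolution. Bundling rank, shifts and kernel keeps the recursion in a single
type. -/
theorem GradedSyzygy.exists_next (s : GradedSyzygy K n) :
    ∃ (t : GradedSyzygy K n) (f : (Fin t.rank → MvPolynomial (Fin n) K) →ₗ[MvPolynomial (Fin n) K]
        (Fin s.rank → MvPolynomial (Fin n) K)),
      (∀ k, f (Pi.single k 1) ∈ freeGrading K n s.shift (t.shift k)) ∧
      LinearMap.range f = s.ker ∧ LinearMap.ker f = t.ker := by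
  have hker := (isGradedPolyModule_free s.shift).submodule s.ker s.proj_mem
  obtain ⟨r, shift, ε, hε, hsurj, hmin⟩ := hker.exists_minimal_presentation
  refine ⟨⟨r, shift, LinearMap.ker ε, hker.proj_mem_ker hε, hmin⟩, s.ker.subtype ∘ₗ ε, hε, ?_, ?_⟩
  · rw [LinearMap.range_comp, LinearMap.range_eq_top.mpr hsurj, Submodule.map_top,
      Submodule.range_subtype]
  · exact LinearMap.ker_comp_of_ker_eq_bot _ s.ker.ker_subtype

/-- Iterated syzygies. -/
noncomputable def GradedSyzygy.iterate (s : GradedSyzygy K n) (i : ℕ) : GradedSyzygy K n :=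
  Nat.rec s (fun _ t => t.exists_next.choose) i

/-- Every finitely generated graded module has a minimal graded free resolution. -/
theorem IsGradedPolyModule.nonempty_minimalGradedFreeResolution
    [Module.Finite (MvPolynomial (Fin n) K) M] (h : IsGradedPolyModule K n ℳ π) :
    Nonempty (MinimalGradedFreeResolution (K := K) (n := n) ℳ) := by
  obtain ⟨r, shift, ε, hε, hsurj, hmin⟩ := h.exists_minimal_presentation
  let s : GradedSyzygy K n := ⟨r, shift, LinearMap.ker ε, h.proj_mem_ker hε, hmin⟩
  have hnext : ∀ i, ∃ f : (Fin (s.iterate (i + 1)).rank → MvPolynomial (Fin n) K)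
      →ₗ[MvPolynomial (Fin n) K] (Fin (s.iterate i).rank → MvPolynomial (Fin n) K),
      (∀ k, f (Pi.single k 1) ∈ freeGrading K n (s.iterate i).shift ((s.iterate (i + 1)).shift k)) ∧
      LinearMap.range f = (s.iterate i).ker ∧ LinearMap.ker f = (s.iterate (i + 1)).ker :=
    fun i => (s.iterate i).exists_next.choose_spec
  choose f hf hrange hker using hnext
  exact ⟨{
    rank := fun i => (s.iterate i).rank
    shift := fun i => (s.iterate i).shift
    diff := f
    aug := ε
    diff_homogeneous := hf
    aug_homogeneous := hε
    aug_surjective := hsurj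
    exact_zero := LinearMap.exact_iff.mpr (hrange 0).symm
    exact_succ := fun i => LinearMap.exact_iff.mpr ((hker i).trans (hrange (i + 1)).symm)
    minimal := fun i k l => (s.iterate i).le _ (hrange i ▸ LinearMap.mem_range_self (f i) _) l }⟩

/-- The regularity of a finitely generated graded module in terms of Koszul homology. -/
theorem IsGradedPolyModule.gradedReg_eq [Module.Finite (MvPolynomial (Fin n) K) M]
    (h : IsGradedPolyModule K n ℳ π) :
    gradedReg K n ℳ = sSup {r : EReal | ∃ (i : ℕ) (j : ℤ),
      KoszulHomologyNonzero (X : Fin n → MvPolynomial (Fin n) K) ℳ 1 ((i : ℤ), j) ∧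
        r = (((j - (i : ℤ) : ℤ) : ℝ) : EReal)} := by
  have hne := h.nonempty_minimalGradedFreeResolution
  -- The resolution chosen in `gradedBetti` is irrelevant, since `exists_shift_iff` holds for each
  -- one.
  have key : ∀ (i : ℕ) (j : ℤ), gradedBetti (K := K) (n := n) ℳ i j ≠ 0 ↔
      KoszulHomologyNonzero (X : Fin n → MvPolynomial (Fin n) K) ℳ 1 ((i : ℤ), j) := by
    intro i j
    rw [← (Classical.choice hne).exists_shift_iff h, gradedBetti, dif_pos hne, ← Nat.pos_iff_ne_zero,
      Fintype.card_pos_iff]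
    exact ⟨fun ⟨k⟩ => ⟨k.1, k.2⟩, fun ⟨k, hk⟩ => ⟨⟨k, hk⟩⟩⟩
  simp only [gradedReg, key]

end Existence

/-! ### Multidegrees of monomials -/

section Weight

theorem map_weight {σ G H : Type*} [AddCommMonoid G] [AddCommMonoid H] (w : σ → G) (φ : G →+ H)
    (α : σ →₀ ℕ) : φ (Finsupp.weight w α) = α.sum fun s k => k • φ (w s) := by
  rw [Finsupp.weight_apply, map_finsuppSum]
  simp only [map_nsmul]

theorem map_weight_nonneg {σ G : Type*} [AddCommMonoid G] (w : σ → G) (φ : G →+ ℤ) (α : σ →₀ ℕ)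
    (h : ∀ s, α s ≠ 0 → 0 ≤ φ (w s)) : 0 ≤ φ (Finsupp.weight w α) := by
  rw [map_weight]
  exact Finset.sum_nonneg fun s hs => nsmul_nonneg (h s (Finsupp.mem_support_iff.mp hs)) _

theorem map_weight_eq_zero {σ G H : Type*} [AddCommMonoid G] [AddCommMonoid H] (w : σ → G)
    (φ : G →+ H) (α : σ →₀ ℕ) (h : ∀ s, α s ≠ 0 → φ (w s) = 0) : φ (Finsupp.weight w α) = 0 := by
  rw [map_weight]
  exact Finset.sum_eq_zero fun s hs => by
    dsimp only
    rw [h s (Finsupp.mem_support_iff.mp hs), smul_zero]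

end Weight

/-! ### The strands of a multigraded module -/

section Strand

open MvPolynomial

variable {K : Type*} [Field K] {n m : ℕ} {g : Fin m → ℕ} {d : (i : Fin m) → Fin (g i) → ℕ}
  {U : Type*} [AddCommGroup U] [Module (MvPolynomial (Fin n ⊕ (Σ i : Fin m, Fin (g i))) K) U]

/-- The projections of a decomposition. -/
def decompositionProj {G M : Type*} [DecidableEq G] [AddCommGroup M] (ℳ : G → AddSubgroup M)
    [DirectSum.Decomposition ℳ] (g : G) : M →+ M :=
  (ℳ g).subtype.comp ((DFinsupp.evalAddMonoidHom g).comp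
    (DirectSum.decomposeAddEquiv ℳ).toAddMonoidHom)

theorem isGradedBy_decomposition {G M : Type*} [DecidableEq G] [AddCommGroup M]
    (ℳ : G → AddSubgroup M) [DirectSum.Decomposition ℳ] :
    IsGradedBy ℳ (decompositionProj ℳ) where
  mem g x := (DirectSum.decompose ℳ x g).2
  self g x hx := DirectSum.decompose_of_mem_same ℳ hx
  other g h x hx hg := DirectSum.decompose_of_mem_ne ℳ hx hg
  closed x N hN := by
    classical
    rw [← DirectSum.sum_support_decompose ℳ x]
    exact sum_mem fun g _ => hN g

theorem X_smul_mem_multigraded (𝒰 : ℤ × (Fin m → ℤ) → AddSubgroup U)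
    [SetLike.GradedSMul (multiGrading K n d) 𝒰]
    (s : Fin n ⊕ (Σ i : Fin m, Fin (g i))) (p : ℤ × (Fin m → ℤ)) (u : U)
    (hu : u ∈ 𝒰 p) : (X s : MvPolynomial _ K) • u ∈ 𝒰 (p + varDegree n d s) := by
  have h := SetLike.GradedSMul.smul_mem (A := multiGrading K n d) (B := 𝒰)
    (isWeightedHomogeneous_X K (varDegree n d) s) hu
  rwa [vadd_eq_add, add_comm] at h

theorem C_smul_mem_multigraded (d : (i : Fin m) → Fin (g i) → ℕ)
    (𝒰 : ℤ × (Fin m → ℤ) → AddSubgroup U) [SetLike.GradedSMul (multiGrading K n d) 𝒰]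
    (a : K) (p : ℤ × (Fin m → ℤ)) (u : U) (hu : u ∈ 𝒰 p) :
    (C a : MvPolynomial (Fin n ⊕ (Σ i : Fin m, Fin (g i))) K) • u ∈ 𝒰 p := by
  have h := SetLike.GradedSMul.smul_mem (A := multiGrading K n d) (B := 𝒰)
    (isWeightedHomogeneous_C (varDegree n d) a) hu
  rwa [vadd_eq_add, zero_add] at h

theorem le_strand {V : Type*} [AddCommGroup V] (𝒰 : ℤ × (Fin m → ℤ) → AddSubgroup V) (i : ℤ)
    (a : Fin m → ℤ) : 𝒰 (i, a) ≤ strand 𝒰 a :=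
  le_iSup (fun i => 𝒰 (i, a)) i

/-- The projections belonging to `strandGrading`. -/
def strandProj {V : Type*} [AddCommGroup V] (𝒰 : ℤ × (Fin m → ℤ) → AddSubgroup V)
    [DirectSum.Decomposition 𝒰] (a : Fin m → ℤ) (i : ℤ) : strand 𝒰 a →+ strand 𝒰 a where
  toFun u := ⟨decompositionProj 𝒰 (i, a) u,
    le_strand 𝒰 i a ((isGradedBy_decomposition 𝒰).mem _ _)⟩
  map_zero' := by ext; simp
  map_add' x y := by ext; simp

theorem decompositionProj_strand {V : Type*} [AddCommGroup V]
    (𝒰 : ℤ × (Fin m → ℤ) → AddSubgroup V) [DirectSum.Decomposition 𝒰] {a : Fin m → ℤ}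
    {p : ℤ × (Fin m → ℤ)} (hp : p.2 ≠ a) {u : V} (hu : u ∈ strand 𝒰 a) :
    decompositionProj 𝒰 p u = 0 := by
  have h : strand 𝒰 a ≤ (decompositionProj 𝒰 p).ker := iSup_le fun i x hx =>
    (isGradedBy_decomposition 𝒰).other _ _ _ hx fun e => hp (congrArg Prod.snd e).symm
  exact h hu

theorem isGradedPolyModule_strand (𝒰 : ℤ × (Fin m → ℤ) → AddSubgroup U)
    [DirectSum.Decomposition 𝒰] [SetLike.GradedSMul (multiGrading K n d) 𝒰] (a : Fin m → ℤ) :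
    letI := strandModule K n d 𝒰 a
    IsGradedPolyModule K n (strandGrading 𝒰 a) (strandProj 𝒰 a) := by
  let _ := strandModule K n d 𝒰 a
  refine
    { toIsGradedBy := (isGradedBy_decomposition 𝒰).restrict (f := (strand 𝒰 a).subtype)
        Subtype.val_injective (φ := fun i => (i, a)) (fun i j h => congrArg Prod.fst h)
        (fun _ _ => rfl) (fun p x hp => decompositionProj_strand 𝒰 ?_ x.2)
      X_smul := fun l j u hu => ?_
      C_smul := fun c j u hu => ?_ }
  · rintro rfl
    exact hp ⟨p.1, rfl⟩
  · change (rename Sum.inl (X l) : MvPolynomial (Fin n ⊕ (Σ i : Fin m, Fin (g i))) K) • (u : U) ∈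
      𝒰 (j + 1, a)
    rw [rename_X]
    simpa [varDegree] using X_smul_mem_multigraded (d := d) 𝒰 (Sum.inl l) (j, a) u hu
  · change (rename Sum.inl (C c) : MvPolynomial (Fin n ⊕ (Σ i : Fin m, Fin (g i))) K) • (u : U) ∈
      𝒰 (j, a)
    rw [rename_C]
    exact C_smul_mem_multigraded d 𝒰 c _ _ hu

/-- No variable has a negative `i`-th coordinate, and each factor `z_{ij}` adds one. This bounds the
exponents of the `z_{ij}` in a fixed strand. -/
theorem weight_varDegree_snd_inr (β : (Fin n ⊕ (Σ i : Fin m, Fin (g i))) →₀ ℕ) (i : Fin m)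
    (j : Fin (g i)) :
    (β (Sum.inr ⟨i, j⟩) : ℤ) ≤ (Finsupp.weight (varDegree n d) β).2 i := by
  classical
  let φ : ℤ × (Fin m → ℤ) →+ ℤ := (Pi.evalAddMonoidHom _ i).comp (AddMonoidHom.snd _ _)
  change _ ≤ φ (Finsupp.weight (varDegree n d) β)
  rw [map_weight]
  have hφ : ∀ s, 0 ≤ φ (varDegree n d s) := by
    rintro (l | ⟨i', j'⟩)
    · simp [φ, varDegree]
    · simp only [φ, varDegree, AddMonoidHom.comp_apply, AddMonoidHom.coe_snd,
        Pi.evalAddMonoidHom_apply, Pi.single_apply]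
      split_ifs <;> simp
  by_cases h : β (Sum.inr ⟨i, j⟩) = 0
  · rw [h]
    exact Finset.sum_nonneg fun s _ => nsmul_nonneg (hφ s) _
  · refine le_trans ?_ (Finset.single_le_sum (f := fun s => β s • φ (varDegree n d s))
      (fun s _ => nsmul_nonneg (hφ s) _) (Finsupp.mem_support_iff.mpr h))
    simp [φ, varDegree]

/-- Over `R` the strand is generated by products of monomials in the `z_{ij}` with homogeneous
generators of `𝒰`; fixing the degree `𝐚` leaves finitely many such products. -/
theorem finite_strand [Module.Finite (MvPolynomial (Fin n ⊕ (Σ i : Fin m, Fin (g i))) K) U]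
    (𝒰 : ℤ × (Fin m → ℤ) → AddSubgroup U)
    [DirectSum.Decomposition 𝒰] [SetLike.GradedSMul (multiGrading K n d) 𝒰] (a : Fin m → ℤ) :
    letI := strandModule K n d 𝒰 a
    Module.Finite (MvPolynomial (Fin n) K) (strand 𝒰 a) := by
  classical
  let _ := strandModule K n d 𝒰 a
  have hgr := isGradedBy_decomposition 𝒰
  have hX := X_smul_mem_multigraded (K := K) (n := n) (d := d) 𝒰
  have hC := C_smul_mem_multigraded (K := K) (n := n) d 𝒰
  obtain ⟨r, δ, u, hu, hspan⟩ := hgr.exists_homogeneous_generators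
    (A := MvPolynomial (Fin n ⊕ (Σ i : Fin m, Fin (g i))) K)
  -- No `x_l`, and for `z_{ij}` a bound valid for all generators at once: the sum over `k` dominates
  -- each `aᵢ - (δ k)ᵢ`.
  let D : (Fin n ⊕ (Σ i : Fin m, Fin (g i))) →₀ ℕ := Finsupp.equivFunOnFinite.symm
    (Sum.elim (fun _ => 0) fun q => ∑ k, (a q.1 - (δ k).2 q.1).toNat)
  let T : Set (strand 𝒰 a) := {v | ∃ k, ∃ β ∈ Set.Icc 0 D, (v : U) = monomial β (1 : K) • u k}
  have hT : T.Finite := by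
    have h1 : (⋃ k, (fun β => monomial β (1 : K) • u k) '' Set.Icc 0 D).Finite :=
      Set.finite_iUnion fun k => (Set.finite_Icc 0 D).image _
    refine (h1.preimage Subtype.val_injective.injOn).subset ?_
    rintro v ⟨k, β, hβ, hv⟩
    exact Set.mem_iUnion.mpr ⟨k, β, hβ, hv.symm⟩
  let N : AddSubgroup U := (Submodule.span (MvPolynomial (Fin n) K) T).toAddSubgroup.map
    (strand 𝒰 a).subtype
  have hN : ∀ (p : MvPolynomial (Fin n) K) (x : U), x ∈ N →
      (rename Sum.inl p : MvPolynomial (Fin n ⊕ (Σ i : Fin m, Fin (g i))) K) • x ∈ N := by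
    rintro p _ ⟨x, hx, rfl⟩
    exact ⟨p • x, Submodule.smul_mem _ p hx, rfl⟩
  have hmon : ∀ i k (α : (Fin n ⊕ (Σ i : Fin m, Fin (g i))) →₀ ℕ),
      δ k + Finsupp.weight (varDegree n d) α = (i, a) → monomial α (1 : K) • u k ∈ N := by
    intro i k α hα
    -- Separate the factor in the `x_l`, which acts through `R`, from the factor `β` in the
    -- `z_{ij}`.
    let α₁ : Fin n →₀ ℕ := α.comapDomain Sum.inl Sum.inl_injective.injOn
    let β := α.filter fun s => s.isRight
    have hαβ : α = α₁.mapDomain Sum.inl + β := by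
      ext s
      rcases s with l | q
      · simp [α₁, β, Finsupp.mapDomain_apply Sum.inl_injective]
      · rw [Finsupp.add_apply, Finsupp.mapDomain_of_notMem_range _ _ (by simp), zero_add]
        exact (Finsupp.filter_apply_pos (fun s : Fin n ⊕ (Σ i : Fin m, Fin (g i)) => s.isRight) α
          rfl).symm
    have hβ2 : (δ k).2 + (Finsupp.weight (varDegree n d) β).2 = a := by
      have h1 := congrArg Prod.snd hα
      rw [Prod.snd_add, hαβ, map_add, Prod.snd_add] at h1
      have h0 : ∀ s, α₁.mapDomain Sum.inl s ≠ 0 → (varDegree n d s).2 = 0 := by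
        rintro (l | q) hs
        · rfl
        · rw [Finsupp.mapDomain_of_notMem_range _ _ (by simp)] at hs
          exact absurd rfl hs
      have h2 : (Finsupp.weight (varDegree n d) (α₁.mapDomain Sum.inl)).2 = 0 :=
        map_weight_eq_zero (varDegree n d) (AddMonoidHom.snd ℤ (Fin m → ℤ)) _ h0
      rwa [h2, zero_add] at h1
    have hβD : β ∈ Set.Icc 0 D := by
      refine ⟨zero_le, ?_⟩
      rintro (l | ⟨i, j⟩)
      · simp [β, D]
      · have h1 := weight_varDegree_snd_inr (d := d) β i j
        have h2 := congrFun hβ2 i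
        rw [Pi.add_apply] at h2
        have h3 : (a i - (δ k).2 i).toNat ≤ ∑ k, (a i - (δ k).2 i).toNat :=
          Finset.single_le_sum (f := fun k => (a i - (δ k).2 i).toNat) (fun _ _ => Nat.zero_le _)
            (Finset.mem_univ k)
        have h4 : D (Sum.inr ⟨i, j⟩) = ∑ k, (a i - (δ k).2 i).toNat := rfl
        omega
    have hmem : monomial β (1 : K) • u k ∈ strand 𝒰 a := by
      have h1 := monomial_smul_mem_graded hX (hu k) β
      refine le_strand 𝒰 (δ k + Finsupp.weight (varDegree n d) β).1 a ?_
      convert h1 using 1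
      rw [← hβ2]
      rfl
    have hfac : monomial α (1 : K) = rename Sum.inl (monomial α₁ 1) * monomial β 1 := by
      rw [rename_monomial, monomial_mul, one_mul, ← hαβ]
    rw [hfac, mul_smul]
    exact hN _ _ ⟨⟨_, hmem⟩, Submodule.subset_span ⟨k, β, hβD, rfl⟩, rfl⟩
  have hle : strand 𝒰 a ≤ N := by
    refine iSup_le fun i x hx => ?_
    obtain ⟨p, rfl⟩ := (Submodule.mem_span_range_iff_exists_fun _).mp
      (hspan ▸ Submodule.mem_top : x ∈ Submodule.span _ (Set.range u))
    rw [← hgr.self _ _ hx, map_sum]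
    refine sum_mem fun k _ => hgr.proj_smul_mem hX hC (hu k) N (fun α c hα => ?_) (p k)
    have := hN (C c) _ (hmon i k α hα)
    rwa [rename_C] at this
  refine Module.finite_def.mpr ?_
  rw [← show Submodule.span (MvPolynomial (Fin n) K) T = ⊤ from ?_]
  · exact Submodule.fg_span hT
  · refine Submodule.eq_top_iff'.mpr fun x => ?_
    obtain ⟨y, hy, hyx⟩ := hle x.2
    exact Subtype.ext hyx ▸ hy

theorem koszulDiff_strand (𝒰 : ℤ × (Fin m → ℤ) → AddSubgroup U)
    [SetLike.GradedSMul (multiGrading K n d) 𝒰] (a : Fin m → ℤ)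
    (c : Finset (Fin n) → strand 𝒰 a) (I : Finset (Fin n)) :
    letI := strandModule K n d 𝒰 a
    (koszulDiff (X : Fin n → MvPolynomial (Fin n) K) (strand 𝒰 a) Finset.univ c I : U) =
      koszulDiff (fun l => (X (Sum.inl l) : MvPolynomial (Fin n ⊕ (Σ i : Fin m, Fin (g i))) K)) U
        Finset.univ (fun I => (c I : U)) I := by
  let _ := strandModule K n d 𝒰 a
  rw [koszulDiff_apply_apply, koszulDiff_apply_apply, AddSubgroup.val_finsetSum]
  refine Finset.sum_congr rfl fun l _ => ?_
  change rename Sum.inl (X l) • ((if l ∈ I then 0 else koszulSign l I • c (insert l I) :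
    strand 𝒰 a) : U) = _
  rw [rename_X]
  split_ifs <;> simp

/-- The Koszul homology of the strands is computed by the Koszul complex of the whole module. -/
theorem koszulHomologyNonzero_strand_iff (𝒰 : ℤ × (Fin m → ℤ) → AddSubgroup U)
    [DirectSum.Decomposition 𝒰] [SetLike.GradedSMul (multiGrading K n d) 𝒰] (a : Fin m → ℤ)
    (i j : ℤ) :
    letI := strandModule K n d 𝒰 a
    KoszulHomologyNonzero (X : Fin n → MvPolynomial (Fin n) K) (strandGrading 𝒰 a) 1 (i, j) ↔
      KoszulHomologyNonzero
        (fun l => (X (Sum.inl l) : MvPolynomial (Fin n ⊕ (Σ i : Fin m, Fin (g i))) K))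
        𝒰 (1, 0) (i, (j, a)) := by
  let _ := strandModule K n d 𝒰 a
  have hgr := isGradedBy_decomposition 𝒰
  have hdeg : ∀ i : ℤ, ((j, a) : ℤ × (Fin m → ℤ)) - i • (1, 0) = (j - i • 1, a) := by
    intro i
    ext <;> simp
  have hproj : ∀ (l : Fin n) (p : ℤ × (Fin m → ℤ)) (u : U),
      decompositionProj 𝒰 (p + (1, 0))
        ((X (Sum.inl l) : MvPolynomial (Fin n ⊕ (Σ i : Fin m, Fin (g i))) K) • u) =
      (X (Sum.inl l) : MvPolynomial (Fin n ⊕ (Σ i : Fin m, Fin (g i))) K) •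
        decompositionProj 𝒰 p u := fun l p u =>
    hgr.proj_map hgr (φ := (· + (1, 0))) (add_left_injective _)
      (DistribSMul.toAddMonoidHom U
        (X (Sum.inl l) : MvPolynomial (Fin n ⊕ (Σ i : Fin m, Fin (g i))) K))
      (fun p u hu => X_smul_mem_multigraded (d := d) 𝒰 (Sum.inl l) p u hu) p u
  constructor
  · rintro ⟨c, hc, hdc, hcb⟩
    have hc' : (fun I => (c I : U)) ∈ koszulGrading n 𝒰 (1, 0) (i, (j, a)) := fun I =>
      ⟨fun hI => by simp only [(hc I).1 hI]; rfl, by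
        dsimp only
        rw [hdeg]
        exact (hc I).2⟩
    refine ⟨fun I => c I, hc', ?_, fun b hb => ?_⟩
    · ext1 I
      rw [← koszulDiff_strand (d := d), hdc]
      rfl
    -- A chain over `𝒰` bounding `c` may leave the strand; its component of the right bidegree does
    -- not, and has the same boundary.
    · have hb' := koszulDiff_proj hproj i (j, a) b
      rw [hb, (hgr.koszul n (1, 0)).self _ _ hc'] at hb'
      have hmem : ∀ I, koszulProj n (decompositionProj 𝒰) (1, 0) (i + 1, (j, a)) b I ∈
          strand 𝒰 a := by
        intro I
        have h1 := ((hgr.koszul n (1, 0)).mem (i + 1, (j, a)) b I).2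
        dsimp only at h1
        rw [hdeg] at h1
        exact le_strand 𝒰 _ a h1
      refine hcb (fun I => ⟨_, hmem I⟩) ?_
      ext1 I
      refine Subtype.ext ?_
      rw [koszulDiff_strand]
      exact congrFun hb' I
  · rintro ⟨c, hc, hdc, hcb⟩
    have hmem : ∀ I, c I ∈ 𝒰 (j - i • 1, a) := fun I => hdeg i ▸ (hc I).2
    refine ⟨fun I => ⟨c I, le_strand 𝒰 _ a (hmem I)⟩,
      fun I => ⟨fun hI => Subtype.ext ((hc I).1 hI), hmem I⟩, ?_, fun b hb => ?_⟩
    · ext1 I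
      refine Subtype.ext ?_
      rw [koszulDiff_strand]
      exact congrFun hdc I
    · refine hcb (fun I => b I) ?_
      ext1 I
      rw [← koszulDiff_strand (d := d), hb]

/-- The degrees in which the Koszul homology of a finitely generated multigraded module is nonzero
form a finite union of shifted monoids generated by degrees of the variables `z_{ij}`. -/
theorem exists_finite_koszulHomology_description
    [Module.Finite (MvPolynomial (Fin n ⊕ (Σ i : Fin m, Fin (g i))) K) U]
    (𝒰 : ℤ × (Fin m → ℤ) → AddSubgroup U)
    [DirectSum.Decomposition 𝒰] [SetLike.GradedSMul (multiGrading K n d) 𝒰] :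
    ∃ F : Set ((ℤ × (ℤ × (Fin m → ℤ))) × Set (Fin n ⊕ (Σ i : Fin m, Fin (g i)))), F.Finite ∧
      (∀ q ∈ F, ∀ l, Sum.inl l ∉ q.2) ∧
      ∀ p, KoszulHomologyNonzero
        (fun l => (X (Sum.inl l) : MvPolynomial (Fin n ⊕ (Σ i : Fin m, Fin (g i))) K))
        𝒰 (1, 0) p ↔
        ∃ q ∈ F, ∃ α : (Fin n ⊕ (Σ i : Fin m, Fin (g i))) →₀ ℕ, (∀ s, α s ≠ 0 → s ∈ q.2) ∧
          p = q.1 + (0, Finsupp.weight (varDegree n d) α) := by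
  have hgr := isGradedBy_decomposition 𝒰
  have hX := X_smul_mem_multigraded (K := K) (n := n) (d := d) 𝒰
  have hproj : ∀ (l : Fin n) (p : ℤ × (Fin m → ℤ)) (u : U),
      decompositionProj 𝒰 (p + (1, 0))
        ((X (Sum.inl l) : MvPolynomial (Fin n ⊕ (Σ i : Fin m, Fin (g i))) K) • u) =
      (X (Sum.inl l) : MvPolynomial (Fin n ⊕ (Σ i : Fin m, Fin (g i))) K) •
        decompositionProj 𝒰 p u := fun l p u =>
    hgr.proj_map hgr (φ := (· + (1, 0))) (add_left_injective _)
      (DistribSMul.toAddMonoidHom U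
        (X (Sum.inl l) : MvPolynomial (Fin n ⊕ (Σ i : Fin m, Fin (g i))) K))
      (fun p u hu => hX (Sum.inl l) p u hu) p u
  let D := koszulDiff
    (fun l : Fin n => (X (Sum.inl l) : MvPolynomial (Fin n ⊕ (Σ i : Fin m, Fin (g i))) K)) U
    Finset.univ
  -- Variables act on chains without changing the homological degree.
  let w : Fin n ⊕ (Σ i : Fin m, Fin (g i)) → ℤ × (ℤ × (Fin m → ℤ)) := fun s => (0, varDegree n d s)
  have hw : ∀ α : (Fin n ⊕ (Σ i : Fin m, Fin (g i))) →₀ ℕ, Finsupp.weight w α = (0, Finsupp.weight (varDegree n d) α) := by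
    intro α
    refine Prod.ext ?_ ?_
    · exact map_weight_eq_zero w (AddMonoidHom.fst _ _) α fun _ _ => rfl
    · exact (map_weight w (AddMonoidHom.snd _ _) α).trans (Finsupp.weight_apply _ _).symm
  obtain ⟨F, hF, hFvar, hFdesc⟩ := exists_finite_support_description (w := w)
    (hgr.koszul n (1, 0))
    (fun s p c hc I => by
      refine ⟨fun hI => ?_, ?_⟩
      · rw [Pi.smul_apply, (hc I).1 (by simpa [w] using hI), smul_zero]
      · have h1 := hX s _ _ (hc I).2
        simpa [w, sub_add_eq_add_sub] using h1)
    (fun a p c hc I => ⟨fun hI => by rw [Pi.smul_apply, (hc I).1 hI, smul_zero],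
      C_smul_mem_multigraded d 𝒰 a _ _ (hc I).2⟩)
    (LinearMap.range D) (LinearMap.ker D)
    (by
      rintro _ ⟨c, rfl⟩
      exact koszulDiff_diff _ _ c)
    (by
      rintro p _ ⟨c, rfl⟩
      exact ⟨_, koszulDiff_proj hproj p.1 p.2 c⟩)
    (by
      intro p c hc
      have h1 : D _ = koszulProj n _ _ _ (D c) := koszulDiff_proj hproj (p.1 - 1) p.2 c
      rw [LinearMap.mem_ker.mp hc, map_zero, sub_add_cancel] at h1
      exact h1)
  refine ⟨F, hF, fun q hq l hl => ?_, fun p => ?_⟩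
  -- Wedging with `e_l` is a homotopy, so `x_l` kills the homology and cannot occur among the
  -- generating variables.
  · obtain ⟨c, hc, hcB⟩ := hFvar q hq _ hl
    refine hcB ⟨koszulWedge (MvPolynomial (Fin n ⊕ (Σ i : Fin m, Fin (g i))) K) U l c, ?_⟩
    have h1 : D (koszulWedge _ U l c) = (X (Sum.inl l) : MvPolynomial _ K) • c -
        koszulWedge (MvPolynomial (Fin n ⊕ (Σ i : Fin m, Fin (g i))) K) U l (D c) := koszulDiff_wedge
      (fun l : Fin n => (X (Sum.inl l) : MvPolynomial (Fin n ⊕ (Σ i : Fin m, Fin (g i))) K))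
      (Finset.mem_univ l) c
    rwa [LinearMap.mem_ker.mp hc, map_zero, sub_zero] at h1
  · simp only [← hw]
    rw [← hFdesc]
    constructor
    · rintro ⟨c, hc, hdc, hcb⟩
      exact ⟨c, hc, hdc, fun ⟨b, hb⟩ => hcb b hb⟩
    · rintro ⟨c, hc, hdc, hcb⟩
      exact ⟨c, hc, hdc, fun b hb => hcb ⟨b, hb⟩⟩

end Strand

/-! ### Asymptotic regularity -/

section Asymptotic

variable {n m : ℕ} {g : Fin m → ℕ} {d : (i : Fin m) → Fin (g i) → ℕ}

/-- If the index set of the allowed `z_{ij}` is empty for some `i`, the `i`-th coordinate of the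
multidegree vanishes. -/
theorem weight_varDegree_snd_eq_zero {J : Set (Fin n ⊕ (Σ i : Fin m, Fin (g i)))} {i : Fin m}
    (hi : ∀ j, Sum.inr ⟨i, j⟩ ∉ J) {α : (Fin n ⊕ (Σ i : Fin m, Fin (g i))) →₀ ℕ}
    (hα : ∀ s, α s ≠ 0 → s ∈ J) : (Finsupp.weight (varDegree n d) α).2 i = 0 := by
  refine map_weight_eq_zero (varDegree n d)
    ((Pi.evalAddMonoidHom (fun _ : Fin m => ℤ) i).comp (AddMonoidHom.snd ℤ (Fin m → ℤ))) α ?_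
  rintro (l | ⟨i', j⟩) hs
  · rfl
  · have h : i ≠ i' := by
      rintro rfl
      exact hi j (hα _ hs)
    simp [varDegree, h]

/-- The functional `∑ᵢ λᵢ pᵢ - p₀` takes the value `λᵢ - d_{ij} ≥ 0` on each allowed `z_{ij}`. It is
`-1` on `x_l`, which is why the `x_l` must be excluded. -/
theorem weight_varDegree_fst_le {J : Set (Fin n ⊕ (Σ i : Fin m, Fin (g i)))}
    (hJ : ∀ l, Sum.inl l ∉ J) {lam : Fin m → ℤ}
    (hlam : ∀ i j, Sum.inr ⟨i, j⟩ ∈ J → (d i j : ℤ) ≤ lam i)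
    {α : (Fin n ⊕ (Σ i : Fin m, Fin (g i))) →₀ ℕ} (hα : ∀ s, α s ≠ 0 → s ∈ J) :
    (Finsupp.weight (varDegree n d) α).1 ≤
      ∑ i, lam i * (Finsupp.weight (varDegree n d) α).2 i := by
  let φ : ℤ × (Fin m → ℤ) →+ ℤ :=
    { toFun := fun p => ∑ i, lam i * p.2 i - p.1
      map_zero' := by simp
      map_add' := fun p q => by
        simp only [Prod.snd_add, Prod.fst_add, Pi.add_apply, mul_add, Finset.sum_add_distrib]
        ring }
  have h : 0 ≤ φ (Finsupp.weight (varDegree n d) α) := by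
    refine map_weight_nonneg _ φ α ?_
    rintro (l | ⟨i, j⟩) hs
    · exact absurd (hα _ hs) (hJ l)
    · have := hlam i j (hα _ hs)
      simp only [φ, varDegree, AddMonoidHom.coe_mk, ZeroHom.coe_mk]
      rw [Finset.sum_eq_single i]
      · simpa using this
      · intro b _ hb
        simp [hb]
      · simp
  exact sub_nonneg.mp h

/-- The witness is the monomial `∏ᵢ z_{i,j(i)}^{aᵢ}`; with `d_{i,j(i)}` maximal it attains the bound
of `weight_varDegree_fst_le`. -/
theorem exists_weight_varDegree_eq {J : Set (Fin n ⊕ (Σ i : Fin m, Fin (g i)))}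
    {j : (i : Fin m) → Fin (g i)} (hj : ∀ i, Sum.inr ⟨i, j i⟩ ∈ J) {a : Fin m → ℤ}
    (ha : ∀ i, 0 ≤ a i) : ∃ α : (Fin n ⊕ (Σ i : Fin m, Fin (g i))) →₀ ℕ,
      (∀ s, α s ≠ 0 → s ∈ J) ∧
        Finsupp.weight (varDegree n d) α = (∑ i, (d i (j i) : ℤ) * a i, a) := by
  classical
  refine ⟨∑ i, Finsupp.single (Sum.inr ⟨i, j i⟩) (a i).toNat, fun s hs => ?_, ?_⟩
  · rw [Finsupp.finsetSum_apply] at hs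
    obtain ⟨i, -, hi⟩ := Finset.exists_ne_zero_of_sum_ne_zero hs
    by_contra hsJ
    refine hi (Finsupp.single_eq_of_ne ?_)
    rintro rfl
    exact hsJ (hj i)
  · simp only [map_sum, Finsupp.weight_single, varDegree]
    refine Prod.ext ?_ ?_
    · rw [Prod.fst_sum]
      refine Finset.sum_congr rfl fun i _ => ?_
      rw [Prod.smul_fst, nsmul_eq_mul, Int.natCast_toNat_eq_self.mpr (ha i), mul_comm]
    · rw [Prod.snd_sum]
      ext1 i
      rw [Finset.sum_apply, Finset.sum_eq_single i]
      · simp [ha i]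
      · intro b _ hb
        simp [hb.symm]
      · simp

end Asymptotic

/-! ### The asymptotic formula for the regularity -/

theorem theorem2p1 (K : Type*) [Field K] (n m : ℕ) (g : Fin m → ℕ)
    (d : (i : Fin m) → Fin (g i) → ℕ) (U : Type*) [AddCommGroup U]
    [Module (MvPolynomial (Fin n ⊕ (Σ i : Fin m, Fin (g i))) K) U]
    [Module.Finite (MvPolynomial (Fin n ⊕ (Σ i : Fin m, Fin (g i))) K) U]
    (𝒰 : ℤ × (Fin m → ℤ) → AddSubgroup U) [DirectSum.Decomposition 𝒰]
    [SetLike.GradedSMul (multiGrading K n d) 𝒰] :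
    ∃ (c : ℕ) (L : Fin c → (Fin m → ℤ) → ℤ), (∀ k, IsLinearWithCoeffsIn d (L k)) ∧
      ∃ b : Fin m → ℕ, ∀ a : Fin m → ℤ, (∀ i, (b i : ℤ) ≤ a i) →
        strandReg K n d 𝒰 a = ⨆ k : Fin c, (((L k a : ℤ) : ℝ) : EReal) := by
  classical
  obtain ⟨F, hF, hFinl, hFdesc⟩ := exists_finite_koszulHomology_description (K := K) (n := n)
    (d := d) 𝒰
  have hreg : ∀ a, strandReg K n d 𝒰 a = sSup {r : EReal | ∃ (i : ℕ) (j : ℤ),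
      (∃ q ∈ F, ∃ α : (Fin n ⊕ (Σ i : Fin m, Fin (g i))) →₀ ℕ, (∀ s, α s ≠ 0 → s ∈ q.2) ∧
          ((i : ℤ), (j, a)) = q.1 + (0, Finsupp.weight (varDegree n d) α)) ∧
        r = (((j - (i : ℤ) : ℤ) : ℝ) : EReal)} := by
    intro a
    let _ := strandModule K n d 𝒰 a
    have _ := finite_strand (K := K) (n := n) (d := d) 𝒰 a
    have h := (isGradedPolyModule_strand (K := K) (n := n) (d := d) 𝒰 a).gradedReg_eq
    simp only [koszulHomologyNonzero_strand_iff (K := K) (n := n) (d := d), hFdesc] at h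
    exact h
  -- Homological degrees are integers in the grading but natural numbers in the regularity; a
  -- nonzero chain has degree `I.card ≥ 0`.
  have hnonneg : ∀ (i : ℤ) p, (∃ q ∈ F, ∃ α : (Fin n ⊕ (Σ i : Fin m, Fin (g i))) →₀ ℕ,
      (∀ s, α s ≠ 0 → s ∈ q.2) ∧ (i, p) = q.1 + (0, Finsupp.weight (varDegree n d) α)) →
      0 ≤ i := by
    intro i p h
    obtain ⟨c, hc, -, hcb⟩ := (hFdesc (i, p)).mpr h
    by_contra hi
    refine hcb 0 ?_
    rw [map_zero]
    ext1 I
    refine ((hc I).1 fun h => hi ?_).symm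
    rw [← show (I.card : ℤ) = i from h]
    positivity
  -- the pieces that contain some `z_{ij}` for every `i`
  let Fg := {q ∈ F | ∀ i, ∃ j, Sum.inr ⟨i, j⟩ ∈ q.2}
  obtain ⟨c, f, hf⟩ := (hF.subset (Set.sep_subset F fun q => ∀ i, ∃ j, Sum.inr ⟨i, j⟩ ∈ q.2) :
    Fg.Finite).fin_embedding
  have hfF : ∀ k, f k ∈ F ∧ ∀ i, ∃ j, Sum.inr ⟨i, j⟩ ∈ (f k).2 := fun k => by
    have : f k ∈ Fg := hf ▸ Set.mem_range_self k
    exact this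
  have hmax : ∀ k i, ∃ j, Sum.inr ⟨i, j⟩ ∈ (f k).2 ∧
      ∀ j', Sum.inr ⟨i, j'⟩ ∈ (f k).2 → (d i j' : ℤ) ≤ d i j := by
    intro k i
    obtain ⟨j, hj, hj'⟩ := Set.exists_max_image
      {j | Sum.inr (⟨i, j⟩ : Σ i : Fin m, Fin (g i)) ∈ (f k).2} (d i)
      (Set.toFinite _) ((hfF k).2 i)
    exact ⟨j, hj, fun j' h => by exact_mod_cast hj' j' h⟩
  choose jm hjm hjmax using hmax
  -- Strictness matters: a piece without any `z_{ij}` for some `i` still meets the strands with `aᵢ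
  -- = q.1.2.2 i`.
  have hbound : ∀ i, ∃ b : ℕ, ∀ q ∈ F, q.1.2.2 i < b := by
    intro i
    obtain ⟨b, hb⟩ := (hF.image fun q => q.1.2.2 i).bddAbove
    refine ⟨(b + 1).toNat, fun q hq => ?_⟩
    have := hb ⟨q, hq, rfl⟩
    dsimp only at this
    omega
  choose b hb using hbound
  -- The largest `j - i` in the `k`-th piece: shift minus homological degree, plus `d_{i,jm k i}`
  -- for each unit of `aᵢ` above the shift.
  refine ⟨c, fun k a => ∑ i, (d i (jm k i) : ℤ) * a i +
    ((f k).1.2.1 - (f k).1.1 - ∑ i, (d i (jm k i) : ℤ) * (f k).1.2.2 i),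
    fun k => ⟨_, _, fun i => ⟨jm k i, rfl⟩, fun a => rfl⟩, b, fun a ha => ?_⟩
  rw [hreg]
  refine le_antisymm (sSup_le ?_) (iSup_le fun k => le_sSup ?_)
  · rintro _ ⟨i, j, ⟨q, hq, α, hα, hp⟩, rfl⟩
    have hi := congrArg Prod.fst hp
    have hj := congrArg (fun p => p.2.1) hp
    have ha' := congrArg (fun p => p.2.2) hp
    simp only [Prod.fst_add, Prod.snd_add, add_zero] at hi hj ha'
    -- A piece missing some `i` would force `aᵢ` to equal its shift, which lies below `b i`.
    have hgood : q ∈ Fg := by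
      refine ⟨hq, fun i => ?_⟩
      by_contra hne
      push Not at hne
      have h1 := congrFun ha' i
      rw [Pi.add_apply, weight_varDegree_snd_eq_zero hne hα] at h1
      have := hb i q hq
      have := ha i
      omega
    obtain ⟨k, rfl⟩ := hf.symm ▸ hgood
    refine le_iSup_of_le k ?_
    have hle := weight_varDegree_fst_le (hFinl _ hq) (hjmax k) hα
    rw [EReal.coe_le_coe_iff, Int.cast_le, hi, hj, ha']
    simp only [Pi.add_apply, mul_add, Finset.sum_add_distrib]
    linarith
  -- The bound is attained, as `a` exceeds the shift in every coordinate.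
  · obtain ⟨α, hα, hw⟩ := exists_weight_varDegree_eq (d := d) (hjm k)
      (a := a - (f k).1.2.2) fun i => by
        have := hb i _ (hfF k).1
        have := ha i
        rw [Pi.sub_apply]
        omega
    have hex : ∃ q ∈ F, ∃ α : (Fin n ⊕ (Σ i : Fin m, Fin (g i))) →₀ ℕ,
        (∀ s, α s ≠ 0 → s ∈ q.2) ∧
        ((f k).1.1, ((f k).1.2.1 + ∑ i, (d i (jm k i) : ℤ) * (a - (f k).1.2.2) i, a)) =
          q.1 + (0, Finsupp.weight (varDegree n d) α) := by
      refine ⟨f k, (hfF k).1, α, hα, ?_⟩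
      rw [hw]
      refine Prod.ext (by simp) (Prod.ext rfl ?_)
      simp
    have h0 := hnonneg _ _ hex
    lift (f k).1.1 to ℕ using h0 with i₀ hi₀
    refine ⟨i₀, _, hex, ?_⟩
    congr 2
    simp only [Pi.sub_apply, mul_sub, Finset.sum_sub_distrib]
    ring
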